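/- Let $m$ be the finite measure $dm(t)=\frac{t}{e^t-1}\,dt$ on $(0,\infty)$, and let $\mathcal H_1$ be the Hilbert space of all functions $f=\mathcal L[\varphi]$, $f(w)=\int_0^\infty e^{-tw}\varphi(t)\,dm(t)$ $(\mathrm{Re}\,w>-\tfrac12)$, with $\varphi\in L_2(m)$, endowed with the inner product $(f_1,f_2)=\int_0^\infty\overline{\varphi_1}\,\varphi_2\,dm$ if $f_i=\mathcal L[\varphi_i]$. For $|z|<1$ let $$(\mathcal Q_zf)(w)=\sum_{n=1}^\infty \frac{z^n}{(w+n)^2}\,f\!\left(\frac1{w+n}\right).$$ On $L_2(m)$ let $(M\varphi)(t)=e^{-t}\varphi(t)$ and $(\mathcal K\varphi)(t)=\int_0^\infty \frac{J_1(2\sqrt{st})}{\sqrt{st}}\,\varphi(s)\,dm(s)$, where $J_1$ is the Bessel function of the first kind of order $1$, and for $z\in\mathbb C\setminus[1,\infty)$ let $\mathcal K_z=z\,(1-M)(1-zM)^{-1}\mathcal K$. Then, for $|z|<1$, $\mathcal Q_z$ is a bounded operator on $\mathcal H_1$, $1-\mathcal Q_z$ has a bounded inverse on $\mathcal H_1$,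 and the operator-valued function $z\mapsto(1-\mathcal Q_z)^{-1}$ is analytic in the open unit disk $\{|z|<1\}$. The function $z\mapsto\mathcal Q_z$ continues analytically to $\mathbb C\setminus[1,\infty)$ as a function with values in the bounded operators on $\mathcal H_1$, and, with $\mathcal Q_z$ denoting this continuation, $z\mapsto(1-\mathcal Q_z)^{-1}$ is a meromorphic continuation of the above function to $\mathbb C\setminus[1,\infty)$. Its poles are exactly the points $z\in\mathbb C\setminus[1,\infty)$ for which $1$ is an eigenvalue of $\mathcal K_z$ on $L_2(m)$; at every other point $z\in\mathbb C\setminus[1,\infty)$ the operator $1-\mathcal Q_z$ has a bounded inverse and the function is analytic. -/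

import Mathlib

open MeasureTheory Set Filter Topology
open scoped ENNReal
noncomputable section
namespace FareyGauss

/-- The density `t / (e^t - 1)` of the measure `m` on the positive half-line. -/
def mDensity (t : ℝ) : ℝ := t / (Real.exp t - 1)

/-- The measure `dm(t) = t / (e^t - 1) dt` on `(0, ∞)`. -/
def m : Measure ℝ :=
  (volume.restrict (Ioi 0)).withDensity fun t => ENNReal.ofReal (mDensity t)

theorem measurable_mDensity : Measurable mDensity := by
  unfold mDensity; fun_prop

theorem mDensity_nonneg {t : ℝ} (ht : 0 < t) : 0 ≤ mDensity t := by
  have : 1 ≤ Real.exp t := Real.one_le_exp ht.le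
  exact div_nonneg ht.le (by linarith)

theorem mDensity_le {t : ℝ} (ht : 0 < t) : mDensity t ≤ (1 + t) * Real.exp (-t) := by
  have h1 : 0 < Real.exp t - 1 := by linarith [Real.add_one_lt_exp ht.ne']
  unfold mDensity
  rw [div_le_iff₀ h1, Real.exp_neg]
  have h2 : t + 1 ≤ Real.exp t := Real.add_one_le_exp t
  have h3 : 0 < Real.exp t := Real.exp_pos t
  field_simp
  nlinarith

/-- `e^{-ct}` is integrable with respect to `m` as soon as `-1 < c`. -/
theorem integrable_exp_m {c : ℝ} (hc : -1 < c) : Integrable (fun t => Real.exp (-c * t)) m := by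
  unfold m
  rw [integrable_withDensity_iff_integrable_smul₀' (by
    exact measurable_mDensity.ennreal_ofReal.aemeasurable) (by simp)]
  set ε : ℝ := min 1 ((1 + c) / 2) with hε
  have he0 : 0 < ε := lt_min one_pos (by linarith)
  have he1 : ε ≤ 1 := min_le_left _ _
  have he2 : ε ≤ (1 + c) / 2 := min_le_right _ _
  have hint : Integrable (fun t => ε⁻¹ * Real.exp (-(1 + c - ε) * t))
      (volume.restrict (Ioi 0)) :=
    (exp_neg_integrableOn_Ioi 0 (by linarith : 0 < 1 + c - ε)).const_mul _
  refine hint.mono' ?_ ?_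
  · have := measurable_mDensity
    exact (by fun_prop : Measurable _).aestronglyMeasurable
  · refine (ae_restrict_iff' measurableSet_Ioi).2 (.of_forall fun t ht => ?_)
    have ht : 0 < t := ht
    rw [ENNReal.toReal_ofReal (mDensity_nonneg ht), norm_smul, Real.norm_eq_abs,
      Real.norm_eq_abs, abs_of_nonneg (mDensity_nonneg ht), abs_of_pos (Real.exp_pos _)]
    have h1 : 1 + t ≤ ε⁻¹ * Real.exp (ε * t) := by
      rw [inv_mul_eq_div, le_div_iff₀ he0]
      nlinarith [Real.add_one_le_exp (ε * t)]
    calc mDensity t * Real.exp (-c * t)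
        ≤ (ε⁻¹ * Real.exp (ε * t) * Real.exp (-t)) * Real.exp (-c * t) := by
          gcongr
          exact (mDensity_le ht).trans (by gcongr)
      _ = ε⁻¹ * Real.exp (-(1 + c - ε) * t) := by
          rw [mul_assoc, mul_assoc, ← Real.exp_add, ← Real.exp_add]
          ring_nf

instance : IsFiniteMeasure m := by
  have h := integrable_exp_m (c := 0) (by norm_num)
  simp only [neg_zero, zero_mul, Real.exp_zero] at h
  simpa using (integrable_const_iff.1 h)

/-- The Hilbert space `L₂(m)`. -/
abbrev L2m : Type := Lp ℂ 2 m

/-- The half-plane `Re w > -1/2`, on which the integrals below converge absolutely. -/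
def HalfPlane : Type := {w : ℂ // -(1 / 2) < w.re}

theorem memLp_cexp (w : HalfPlane) :
    MemLp (fun t : ℝ => Complex.exp (-(t : ℂ) * w.1)) 2 m := by
  rw [memLp_two_iff_integrable_sq_norm (by fun_prop)]
  have h := integrable_exp_m (c := 2 * w.1.re) (by linarith [w.2])
  refine h.congr (.of_forall fun t => ?_)
  simp only [Complex.norm_exp]
  rw [← Real.exp_nat_mul]
  congr 1
  simp
  ring

theorem integrable_laplace (w : HalfPlane) (φ : L2m) :
    Integrable (fun t : ℝ => Complex.exp (-(t : ℂ) * w.1) * φ t) m :=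
  (memLp_cexp w).integrable_mul (Lp.memLp φ)

/-- The generalized Laplace transform `(𝓛[φ])(w) = ∫ e^{-tw} φ(t) dm(t)`. -/
def laplace : L2m →ₗ[ℂ] (HalfPlane → ℂ) where
  toFun φ w := ∫ t : ℝ, Complex.exp (-(t : ℂ) * w.1) * φ t ∂m
  map_add' φ ψ := by
    funext w
    rw [Pi.add_apply, ← integral_add (integrable_laplace w φ) (integrable_laplace w ψ)]
    refine integral_congr_ae ?_
    filter_upwards [Lp.coeFn_add φ ψ] with t ht
    rw [ht, Pi.add_apply, mul_add]
  map_smul' c φ := by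
    funext w
    rw [Pi.smul_apply, RingHom.id_apply, smul_eq_mul, ← integral_const_mul]
    refine integral_congr_ae ?_
    filter_upwards [Lp.coeFn_smul c φ] with t ht
    rw [ht, Pi.smul_apply, smul_eq_mul]
    ring

theorem ae_eq_zero_of_fourier {u : ℝ → ℝ} (hu : Integrable u m)
    (h : ∀ ξ : ℝ, ∫ t : ℝ, Complex.exp (ξ * t * Complex.I) * (u t : ℂ) ∂m = 0) :
    u =ᵐ[m] 0 := by
  have key : ∀ v : ℝ → ℝ, Integrable v m → ∀ ξ : ℝ,
      charFun (m.withDensity fun t => ENNReal.ofReal (v t)) ξ =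
        ∫ t : ℝ, Complex.exp (ξ * t * Complex.I) * ((max (v t) 0 : ℝ) : ℂ) ∂m := by
    intro v hv ξ
    rw [charFun_apply_real, integral_withDensity_eq_integral_toReal_smul₀
      hv.aemeasurable.ennreal_ofReal (by simp)]
    refine integral_congr_ae (.of_forall fun t => ?_)
    simp only [ENNReal.toReal_ofReal', Complex.real_smul]
    ring
  have fin : ∀ v : ℝ → ℝ, Integrable v m →
      IsFiniteMeasure (m.withDensity fun t => ENNReal.ofReal (v t)) := fun v hv =>
    isFiniteMeasure_withDensity_ofReal hv.2
  have i1 := fin u hu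
  have i2 := fin (-u) hu.neg
  have ibd : ∀ v : ℝ → ℝ, Integrable v m → ∀ ξ : ℝ,
      Integrable (fun t : ℝ => Complex.exp (ξ * t * Complex.I) * ((max (v t) 0 : ℝ) : ℂ)) m := by
    intro v hv ξ
    refine Integrable.bdd_mul (c := 1) (hv.pos_part.ofReal) (by fun_prop) (.of_forall fun t => ?_)
    rw [← Complex.ofReal_mul, Complex.norm_exp_ofReal_mul_I]
  have heq : (m.withDensity fun t => ENNReal.ofReal (u t)) =
      m.withDensity fun t => ENNReal.ofReal ((-u) t) := by
    refine Measure.ext_of_charFun (funext fun ξ => ?_)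
    rw [key u hu, key (-u) hu.neg, ← sub_eq_zero, ← integral_sub (ibd u hu ξ) (ibd _ hu.neg ξ),
      ← h ξ]
    refine integral_congr_ae (.of_forall fun t => ?_)
    simp only [Pi.neg_apply]
    rw [← mul_sub, ← Complex.ofReal_sub]
    congr 2
    rcases le_total (u t) 0 with hh | hh
    · rw [max_eq_right hh, max_eq_left (by linarith)]; ring
    · rw [max_eq_left hh, max_eq_right (by linarith)]; ring
  have := (withDensity_eq_iff hu.aemeasurable.ennreal_ofReal
    hu.neg.aemeasurable.ennreal_ofReal (by
      have := hu.lintegral_lt_top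
      exact this.ne)).1 heq
  filter_upwards [this] with t ht
  simp only [Pi.neg_apply] at ht
  have ht' := congrArg ENNReal.toReal ht
  simp only [ENNReal.toReal_ofReal'] at ht'
  simp only [Pi.zero_apply]
  rcases le_total (u t) 0 with hh | hh
  · rw [max_eq_right hh, max_eq_left (by linarith)] at ht'; linarith
  · rw [max_eq_left hh, max_eq_right (by linarith)] at ht'; linarith

theorem laplace_injective : Function.Injective laplace := by
  refine (injective_iff_map_eq_zero laplace).2 fun φ hφ => ?_
  have hint : Integrable φ m := (Lp.memLp φ).integrable (by norm_num)
  have hF : ∀ ξ : ℝ, ∫ t : ℝ, Complex.exp (ξ * t * Complex.I) * φ t ∂m = 0 := by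
    intro ξ
    have := congrFun hφ ⟨-(ξ * Complex.I), by simp⟩
    refine Eq.trans ?_ this
    refine integral_congr_ae (.of_forall fun t => ?_)
    simp only
    congr 2
    ring
  have hG : ∀ ξ : ℝ, ∫ t : ℝ, Complex.exp (ξ * t * Complex.I) *
      (starRingEnd ℂ) (φ t) ∂m = 0 := by
    intro ξ
    have := congrArg (starRingEnd ℂ) (hF (-ξ))
    rw [← integral_conj, map_zero] at this
    refine Eq.trans ?_ this
    refine integral_congr_ae (.of_forall fun t => ?_)
    simp [← Complex.exp_conj]
  have hconj : Integrable (fun t => (starRingEnd ℂ) (φ t)) m :=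
    (LinearIsometryEquiv.integrable_comp_iff (φ := φ) Complex.conjLIE).2 hint
  have ib : ∀ (ξ : ℝ) {v : ℝ → ℂ}, Integrable v m →
      Integrable (fun t : ℝ => Complex.exp (ξ * t * Complex.I) * v t) m := by
    intro ξ v hv
    refine Integrable.bdd_mul (c := 1) hv (by fun_prop) (.of_forall fun t => ?_)
    rw [← Complex.ofReal_mul, Complex.norm_exp_ofReal_mul_I]
  have hre := ae_eq_zero_of_fourier (u := fun t => (φ t).re) hint.re fun ξ => by
    have : ∀ t : ℝ, Complex.exp (ξ * t * Complex.I) * ((φ t).re : ℂ) =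
        (1 / 2) * (Complex.exp (ξ * t * Complex.I) * φ t +
          Complex.exp (ξ * t * Complex.I) * (starRingEnd ℂ) (φ t)) := by
      intro t
      rw [← mul_add, Complex.add_conj]; push_cast; ring
    simp_rw [this]
    rw [integral_const_mul, integral_add (ib ξ hint) (ib ξ hconj), hF, hG]
    simp
  have him := ae_eq_zero_of_fourier (u := fun t => (φ t).im) hint.im fun ξ => by
    have : ∀ t : ℝ, Complex.exp (ξ * t * Complex.I) * ((φ t).im : ℂ) =
        (-Complex.I / 2) * (Complex.exp (ξ * t * Complex.I) * φ t -
          Complex.exp (ξ * t * Complex.I) * (starRingEnd ℂ) (φ t)) := by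
      intro t
      rw [← mul_sub, Complex.sub_conj]; push_cast; ring_nf; simp
    simp_rw [this]
    rw [integral_const_mul, integral_sub (ib ξ hint) (ib ξ hconj), hF, hG]
    simp
  refine (Lp.eq_zero_iff_ae_eq_zero).2 ?_
  filter_upwards [hre, him] with t h1 h2
  exact Complex.ext h1 h2

/-- The space `H₁` of all generalized Laplace transforms `𝓛[φ]`, `φ ∈ L₂(m)`, as functions on the
half-plane `Re w > -1/2`.  (A type of its own, so that it carries only the Hilbert space structure
defined below and not the topology of pointwise convergence.) -/
def H1 : Type := LinearMap.range laplace

instance : AddCommGroup H1 := inferInstanceAs (AddCommGroup (LinearMap.range laplace))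

instance : Module ℂ H1 := inferInstanceAs (Module ℂ (LinearMap.range laplace))

instance : CoeFun H1 fun _ => HalfPlane → ℂ := ⟨fun f => f.1⟩

/-- The linear bijection `φ ↦ 𝓛[φ]` of `L₂(m)` onto `H₁`. -/
def laplaceEquiv : L2m ≃ₗ[ℂ] H1 := LinearEquiv.ofInjective laplace laplace_injective

/-- The inner product of `H₁`: `(f₁, f₂) = ∫ conj (φ₁) φ₂ dm` if `fᵢ = 𝓛[φᵢ]`. -/
abbrev h1Core : InnerProductSpace.Core ℂ H1 where
  inner f g := inner ℂ (laplaceEquiv.symm f) (laplaceEquiv.symm g)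
  conj_inner_symm f g := inner_conj_symm _ _
  re_inner_nonneg f := inner_self_nonneg
  add_left f g h := by simp only [map_add, inner_add_left]
  smul_left f g c := by simp only [map_smul, inner_smul_left]
  definite f h := by
    have := inner_self_eq_zero.1 h
    simpa using this

instance : NormedAddCommGroup H1 := h1Core.toNormedAddCommGroup

instance : InnerProductSpace ℂ H1 := InnerProductSpace.ofCore h1Core.toCore

theorem h1_inner_laplace (φ ψ : L2m) :
    inner ℂ (laplaceEquiv φ) (laplaceEquiv ψ) =
      ∫ t : ℝ, (starRingEnd ℂ) (φ t) * ψ t ∂m := by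
  change inner ℂ (laplaceEquiv.symm (laplaceEquiv φ)) (laplaceEquiv.symm (laplaceEquiv ψ)) = _
  rw [LinearEquiv.symm_apply_apply, LinearEquiv.symm_apply_apply, L2.inner_def]
  refine integral_congr_ae (.of_forall fun t => ?_)
  simp [mul_comm]

/-- The Laplace transform as an isometry of `L₂(m)` onto `H₁`. -/
def laplaceIsometry : L2m ≃ₗᵢ[ℂ] H1 :=
  laplaceEquiv.isometryOfInner fun φ ψ => by
    change inner ℂ (laplaceEquiv.symm (laplaceEquiv φ)) (laplaceEquiv.symm (laplaceEquiv ψ)) = _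
    rw [LinearEquiv.symm_apply_apply, LinearEquiv.symm_apply_apply]

instance : CompleteSpace H1 :=
  (completeSpace_congr (e := laplaceIsometry.toEquiv)
    laplaceIsometry.isometry.isUniformEmbedding).1 inferInstance

/-- The Bessel function `J_p` of the first kind, of integer order `p`. -/
def besselJ (p : ℕ) (x : ℝ) : ℝ :=
  ∑' k : ℕ, (-1) ^ k / ((k.factorial : ℝ) * ((k + p).factorial : ℝ)) * (x / 2) ^ (2 * k + p)

/-- The series `∑ (-x)^k / (k! (k+p)!)`, so that `J_p(x) = (x/2)^p c_p(x²/4)`. -/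
def besselC (p : ℕ) (x : ℝ) : ℝ :=
  ∑' k : ℕ, (-x) ^ k / ((k.factorial : ℝ) * ((k + p).factorial : ℝ))

theorem besselC_term_le (p k : ℕ) {x R : ℝ} (hx : |x| ≤ R) :
    ‖(-x) ^ k / ((k.factorial : ℝ) * ((k + p).factorial : ℝ))‖ ≤ R ^ k / (k.factorial : ℝ) := by
  have h1 : (1 : ℝ) ≤ ((k + p).factorial : ℝ) := by exact_mod_cast (k + p).factorial_pos
  have h2 : (0 : ℝ) < (k.factorial : ℝ) := by exact_mod_cast k.factorial_pos
  have hR : 0 ≤ R := (abs_nonneg x).trans hx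
  rw [norm_div, norm_pow, norm_neg, Real.norm_eq_abs, Real.norm_of_nonneg (by positivity)]
  gcongr
  nlinarith

theorem summable_besselC (p : ℕ) (x : ℝ) :
    Summable fun k : ℕ => (-x) ^ k / ((k.factorial : ℝ) * ((k + p).factorial : ℝ)) :=
  .of_norm_bounded (Real.summable_pow_div_factorial |x|) fun k => besselC_term_le p k le_rfl

theorem besselJ_eq (p : ℕ) (x : ℝ) : besselJ p x = (x / 2) ^ p * besselC p (x ^ 2 / 4) := by
  unfold besselJ besselC
  rw [← tsum_mul_left]
  refine tsum_congr fun k => ?_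
  rw [pow_add, pow_mul, neg_pow (x ^ 2 / 4)]
  have : (x / 2) ^ 2 = x ^ 2 / 4 := by ring
  rw [this]
  ring

theorem hasDerivAt_besselC (p : ℕ) (x : ℝ) :
    HasDerivAt (besselC p) (-besselC (p + 1) x) x := by
  set R : ℝ := |x| + 1
  have hu : Summable fun k : ℕ => ((k : ℝ) * R ^ (k - 1)) / (k.factorial : ℝ) := by
    rw [← summable_nat_add_iff 1]
    refine (Real.summable_pow_div_factorial R).congr fun k => ?_
    rw [Nat.factorial_succ, Nat.add_sub_cancel]
    push_cast
    have : (k.factorial : ℝ) ≠ 0 := by exact_mod_cast k.factorial_ne_zero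
    field_simp
  have hg : ∀ (k : ℕ) (y : ℝ), y ∈ Metric.ball (0 : ℝ) R →
      HasDerivAt (fun y : ℝ => (-y) ^ k / ((k.factorial : ℝ) * ((k + p).factorial : ℝ)))
        ((k * (-y) ^ (k - 1) * (-1)) / ((k.factorial : ℝ) * ((k + p).factorial : ℝ))) y := by
    intro k y _
    exact ((hasDerivAt_neg y).pow k).div_const _
  have hb : ∀ (k : ℕ) (y : ℝ), y ∈ Metric.ball (0 : ℝ) R →
      ‖(k * (-y) ^ (k - 1) * (-1)) / ((k.factorial : ℝ) * ((k + p).factorial : ℝ))‖ ≤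
        ((k : ℝ) * R ^ (k - 1)) / (k.factorial : ℝ) := by
    intro k y hy
    have hy' : |y| ≤ R := by simpa using (Metric.mem_ball.1 hy).le
    have h1 : (1 : ℝ) ≤ ((k + p).factorial : ℝ) := by exact_mod_cast (k + p).factorial_pos
    have h2 : (0 : ℝ) < (k.factorial : ℝ) := by exact_mod_cast k.factorial_pos
    rw [norm_div, norm_mul, norm_mul, norm_pow, norm_neg, norm_neg, Real.norm_eq_abs y,
      Real.norm_of_nonneg (by positivity : (0 : ℝ) ≤ k.factorial * ((k + p).factorial : ℝ)),
      norm_one, mul_one, Real.norm_of_nonneg (Nat.cast_nonneg k)]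
    gcongr
    nlinarith
  have hx : x ∈ Metric.ball (0 : ℝ) R := by simp [R]
  have h := hasDerivAt_tsum_of_isPreconnected hu Metric.isOpen_ball
    (convex_ball (0 : ℝ) R).isPreconnected hg hb hx (summable_besselC p x) hx
  refine h.congr_deriv ?_
  have hs : Summable fun k : ℕ =>
      (k * (-x) ^ (k - 1) * (-1)) / ((k.factorial : ℝ) * ((k + p).factorial : ℝ)) :=
    .of_norm_bounded hu fun k => hb k x hx
  rw [hs.tsum_eq_zero_add]
  unfold besselC
  rw [← tsum_neg]
  simp only [CharP.cast_eq_zero, zero_mul, zero_div, zero_add]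
  refine tsum_congr fun k => ?_
  rw [Nat.factorial_succ, Nat.add_sub_cancel, show k + 1 + p = k + (p + 1) by ring]
  push_cast
  have h1 : (k.factorial : ℝ) ≠ 0 := by exact_mod_cast k.factorial_ne_zero
  have h2 : ((k + (p + 1)).factorial : ℝ) ≠ 0 := by exact_mod_cast Nat.factorial_ne_zero _
  have h3 : (k : ℝ) + 1 ≠ 0 := by positivity
  field_simp

theorem besselC_rec (p : ℕ) (x : ℝ) :
    besselC p x = (p + 1) * besselC (p + 1) x - x * besselC (p + 2) x := by
  have hs := (summable_besselC p x).sub ((summable_besselC (p + 1) x).mul_left ((p : ℝ) + 1))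
  have key : besselC p x - (p + 1) * besselC (p + 1) x = -x * besselC (p + 2) x := by
    unfold besselC
    rw [← tsum_mul_left, ← (summable_besselC p x).tsum_sub
      ((summable_besselC (p + 1) x).mul_left ((p : ℝ) + 1)), hs.tsum_eq_zero_add, ← tsum_mul_left]
    have h0 : (p.factorial : ℝ) ≠ 0 := by exact_mod_cast p.factorial_ne_zero
    have h0' : (p : ℝ) + 1 ≠ 0 := by positivity
    have hz : (-x) ^ 0 / (((0 : ℕ).factorial : ℝ) * ((0 + p).factorial : ℝ)) -
        (p + 1) * ((-x) ^ 0 / (((0 : ℕ).factorial : ℝ) * ((0 + (p + 1)).factorial : ℝ))) = 0 := by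
      simp only [zero_add, Nat.factorial_succ, Nat.factorial_zero]
      push_cast
      field_simp
      ring
    rw [hz, zero_add]
    refine tsum_congr fun k => ?_
    have h1 : (k.factorial : ℝ) ≠ 0 := by exact_mod_cast k.factorial_ne_zero
    have h2 : ((k + 1 + p).factorial : ℝ) ≠ 0 := by exact_mod_cast Nat.factorial_ne_zero _
    have h3 : (k : ℝ) + 1 ≠ 0 := by positivity
    have h4 : (k : ℝ) + 1 + p + 1 ≠ 0 := by positivity
    rw [show k + 1 + (p + 1) = (k + 1 + p) + 1 by ring,
      show k + (p + 2) = (k + 1 + p) + 1 by ring, Nat.factorial_succ k,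
      Nat.factorial_succ (k + 1 + p)]
    push_cast
    field_simp
    ring
  linarith

/-- `|J₁(2√x) / √x| ≤ 1` in the form used below. -/
theorem abs_besselC_one_le {x : ℝ} (hx : 0 ≤ x) : |besselC 1 x| ≤ 1 := by
  set E : ℝ → ℝ := fun y => besselC 1 y ^ 2 + y * besselC 2 y ^ 2 with hE
  have hd : ∀ y, HasDerivAt E (-3 * besselC 2 y ^ 2) y := by
    intro y
    have h1 := hasDerivAt_besselC 1 y
    have h2 := hasDerivAt_besselC 2 y
    refine ((h1.pow 2).add ((hasDerivAt_id y).mul (h2.pow 2))).congr_deriv ?_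
    have h3 := besselC_rec 1 y
    norm_num at h3 ⊢
    rw [h3]
    ring
  have hanti : AntitoneOn E (Ici 0) := by
    refine antitoneOn_of_deriv_nonpos (convex_Ici 0)
      (fun y _ => (hd y).continuousAt.continuousWithinAt)
      (fun y _ => (hd y).differentiableAt.differentiableWithinAt) fun y _ => ?_
    rw [(hd y).deriv]
    nlinarith [sq_nonneg (besselC 2 y)]
  have h0 : E 0 = 1 := by
    have : besselC 1 0 = 1 := by
      unfold besselC
      rw [tsum_eq_single 0 (by intro k hk; simp [hk])]
      simp
    simp [hE, this]
  have h1 := hanti (mem_Ici.2 le_rfl) (mem_Ici.2 hx) hx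
  rw [h0] at h1
  have h2 : 0 ≤ x * besselC 2 x ^ 2 := by positivity
  rw [← sq_le_one_iff_abs_le_one]
  simp only [hE] at h1
  linarith

/-- The kernel `J₁(2√(st)) / √(st)`. -/
def kernelK (s t : ℝ) : ℝ := besselJ 1 (2 * √(s * t)) / √(s * t)

theorem measurable_kernelK : Measurable fun q : ℝ × ℝ => kernelK q.1 q.2 := by
  have h : Continuous (besselC 1) :=
    continuous_iff_continuousAt.2 fun x => (hasDerivAt_besselC 1 x).continuousAt
  have hJ : Continuous (besselJ 1) := by
    have : besselJ 1 = fun x => (x / 2) ^ 1 * besselC 1 (x ^ 2 / 4) := funext (besselJ_eq 1)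
    rw [this]
    fun_prop
  unfold kernelK
  exact (hJ.measurable.comp (by fun_prop)).div (by fun_prop)

theorem abs_kernelK_le (s t : ℝ) : |kernelK s t| ≤ 1 := by
  unfold kernelK
  rw [besselJ_eq]
  set r := √(s * t)
  rcases eq_or_ne r 0 with h | h
  · simp [h]
  · have : (2 * r / 2) ^ 1 * besselC 1 ((2 * r) ^ 2 / 4) / r = besselC 1 (r ^ 2) := by
      have e : (2 * r) ^ 2 / 4 = r ^ 2 := by ring
      rw [e]; field_simp
    rw [this]
    exact abs_besselC_one_le (sq_nonneg r)

theorem integrable_kernelK_mul (φ : L2m) (t : ℝ) :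
    Integrable (fun s : ℝ => (kernelK s t : ℂ) * φ s) m := by
  have hφ : Integrable φ m := (Lp.memLp φ).integrable (by norm_num)
  refine Integrable.bdd_mul (c := 1) hφ ?_ (.of_forall fun s => ?_)
  · exact (Complex.measurable_ofReal.comp
      (measurable_kernelK.comp (measurable_id.prodMk measurable_const))).aestronglyMeasurable
  · rw [Complex.norm_real]; exact abs_kernelK_le s t

theorem norm_kernelK_integral_le (φ : L2m) (t : ℝ) :
    ‖∫ s : ℝ, (kernelK s t : ℂ) * φ s ∂m‖ ≤ ∫ s, ‖φ s‖ ∂m := by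
  have hφ : Integrable φ m := (Lp.memLp φ).integrable (by norm_num)
  refine norm_integral_le_of_norm_le hφ.norm (.of_forall fun s => ?_)
  rw [norm_mul, Complex.norm_real]
  exact mul_le_of_le_one_left (norm_nonneg _) (abs_kernelK_le s t)

theorem memLp_kernelK_integral (φ : L2m) :
    MemLp (fun t : ℝ => ∫ s : ℝ, (kernelK s t : ℂ) * φ s ∂m) 2 m := by
  refine MemLp.of_bound ?_ (∫ s, ‖φ s‖ ∂m) (.of_forall (norm_kernelK_integral_le φ))
  refine StronglyMeasurable.aestronglyMeasurable ?_
  refine StronglyMeasurable.integral_prod_right' (f := fun q : ℝ × ℝ => (kernelK q.2 q.1 : ℂ) * φ q.2) ?_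
  refine StronglyMeasurable.mul ?_ ((Lp.stronglyMeasurable φ).comp_measurable measurable_snd)
  exact (Complex.measurable_ofReal.comp
      (measurable_kernelK.comp measurable_swap)).stronglyMeasurable

theorem integral_norm_le (φ : L2m) : ∫ s, ‖φ s‖ ∂m ≤ √(m.real univ) * ‖φ‖ := by
  have h := eLpNorm_le_eLpNorm_mul_rpow_measure_univ (p := 1) (q := 2) (μ := m) (by norm_num)
    (Lp.aestronglyMeasurable φ)
  rw [integral_norm_eq_lintegral_enorm (Lp.aestronglyMeasurable φ), ← eLpNorm_one_eq_lintegral_enorm]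
  have hfin : eLpNorm φ 2 m * m univ ^ (1 / (1 : ℝ≥0∞).toReal - 1 / (2 : ℝ≥0∞).toReal) ≠ ∞ := by
    refine ENNReal.mul_ne_top (Lp.eLpNorm_ne_top φ) ?_
    exact ENNReal.rpow_ne_top_of_nonneg (by norm_num) (measure_ne_top _ _)
  refine (ENNReal.toReal_mono hfin h).trans (le_of_eq ?_)
  rw [ENNReal.toReal_mul, ← ENNReal.toReal_rpow, Lp.norm_def, mul_comm, Real.sqrt_eq_rpow]
  norm_num [Measure.real]

/-- The integral operator `(𝓚φ)(t) = ∫ J₁(2√(st)) / √(st) φ(s) dm(s)` on `L₂(m)`. -/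
def opK : L2m →L[ℂ] L2m :=
  LinearMap.mkContinuous
    { toFun := fun φ => (memLp_kernelK_integral φ).toLp
      map_add' := fun φ ψ => by
        rw [← MemLp.toLp_add]
        refine MemLp.toLp_congr _ _ (.of_forall fun t => ?_)
        simp only [Pi.add_apply]
        rw [← integral_add (integrable_kernelK_mul φ t) (integrable_kernelK_mul ψ t)]
        refine integral_congr_ae ?_
        filter_upwards [Lp.coeFn_add φ ψ] with s hs
        rw [hs, Pi.add_apply, mul_add]
      map_smul' := fun c φ => by
        rw [RingHom.id_apply, ← MemLp.toLp_const_smul]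
        refine MemLp.toLp_congr _ _ (.of_forall fun t => ?_)
        simp only [Pi.smul_apply, smul_eq_mul]
        rw [← integral_const_mul]
        refine integral_congr_ae ?_
        filter_upwards [Lp.coeFn_smul c φ] with s hs
        rw [hs, Pi.smul_apply, smul_eq_mul]
        ring }
    (m.real univ)
    fun φ => by
      simp only [LinearMap.coe_mk, AddHom.coe_mk]
      have h1 : ∀ᵐ t ∂m, ‖(memLp_kernelK_integral φ).toLp _ t‖ ≤ ∫ s, ‖φ s‖ ∂m := by
        filter_upwards [(memLp_kernelK_integral φ).coeFn_toLp] with t ht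
        rw [ht]
        exact norm_kernelK_integral_le φ t
      have h2 := Lp.norm_le_of_ae_bound (integral_nonneg fun _ => norm_nonneg _) h1
      refine h2.trans ?_
      have h3 : ((measureUnivNNReal m : ℝ)) ^ (ENNReal.toReal 2)⁻¹ = √(m.real univ) := by
        rw [Real.sqrt_eq_rpow]
        norm_num [Measure.real, measureUnivNNReal]
        rfl
      calc _ ≤ √(m.real univ) * (√(m.real univ) * ‖φ‖) := by
            rw [h3]
            exact mul_le_mul_of_nonneg_left (integral_norm_le φ) (Real.sqrt_nonneg _)
        _ = m.real univ * ‖φ‖ := by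
            rw [← mul_assoc, Real.mul_self_sqrt measureReal_nonneg]

theorem opK_apply_ae (φ : L2m) :
    opK φ =ᵐ[m] fun t => ∫ s : ℝ, (kernelK s t : ℂ) * φ s ∂m :=
  (memLp_kernelK_integral φ).coeFn_toLp

theorem memLp_top_exp_neg : MemLp (fun t : ℝ => Complex.exp (-(t : ℂ))) ∞ m := by
  refine memLp_top_of_bound (by fun_prop) 1 ?_
  refine (withDensity_absolutelyContinuous _ _).ae_le ?_
  refine (ae_restrict_iff' measurableSet_Ioi).2 (.of_forall fun t ht => ?_)
  have ht : 0 < t := ht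
  rw [Complex.norm_exp]
  simpa using ht.le

/-- The multiplication operator `(Mφ)(t) = e^{-t} φ(t)` on `L₂(m)`. -/
def opM : L2m →L[ℂ] L2m :=
  (ContinuousLinearMap.mul ℂ ℂ).holderL m ∞ 2 2 memLp_top_exp_neg.toLp

theorem opM_apply_ae (φ : L2m) : opM φ =ᵐ[m] fun t => Complex.exp (-(t : ℂ)) * φ t := by
  refine ((ContinuousLinearMap.mul ℂ ℂ).coeFn_holder (r := 2) memLp_top_exp_neg.toLp φ).trans ?_
  filter_upwards [memLp_top_exp_neg.coeFn_toLp] with t ht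
  simp [ht]

/-- The operator `𝓚_z = z (1 - M) (1 - zM)⁻¹ 𝓚` on `L₂(m)`.  The inverse is taken in the algebra
of bounded operators; it exists for every `z` outside the ray `[1, ∞)`. -/
def opKz (z : ℂ) : L2m →L[ℂ] L2m :=
  z • ((1 - opM) * Ring.inverse (1 - z • opM) * opK)

/-- The inverse branch `Φ_n(w) = 1 / (w + n)` of the Gauss map; as a map of the half-plane into
itself it is defined for `n ≥ 1`, whence the shift of the index: `gaussBranch n = Φ_{n+1}`. -/
def gaussBranch (n : ℕ) (w : HalfPlane) : HalfPlane :=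
  ⟨1 / (w.1 + (n + 1 : ℕ)), by
    have h : 0 < (w.1 + (n + 1 : ℕ)).re := by
      have := w.2
      have hn : (0 : ℝ) ≤ n := n.cast_nonneg
      simp only [Complex.add_re, Complex.natCast_re]
      push_cast
      linarith
    have h2 : 0 ≤ (1 / (w.1 + (n + 1 : ℕ))).re := by
      rw [one_div, Complex.inv_re]
      exact div_nonneg h.le (Complex.normSq_nonneg _)
    linarith⟩

/-- `T` is the operator `𝓠_z` on `H₁`:
`(T f)(w) = ∑_{n ≥ 1} z^n (w + n)⁻² f(1 / (w + n))` for all `f ∈ H₁` and all `w`. -/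
def IsTransferOperator (z : ℂ) (T : H1 →L[ℂ] H1) : Prop :=
  ∀ (f : H1) (w : HalfPlane),
    HasSum (fun n : ℕ => z ^ (n + 1) * (1 / (w.1 + (n + 1 : ℕ))) ^ 2 * f (gaussBranch n w)) (T f w)

/-- The plane cut along the ray `[1, ∞)`. -/
def cutPlane : Set ℂ := {z | ∀ x : ℝ, 1 ≤ x → z ≠ x}

end FareyGauss

end

/-! The Laplace transform is an isometry of `L2m` onto `H1`, and it turns `opKz z` into the transfer
operator. Since `m` has density `t / (e^t - 1)`, the factor `1 - M` cancels the denominator, and the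
classical integral `∫ e^{-ut} t c₁(st) dt = u⁻² e^{-s/u}` with `u = w + n + 1` shows that `M^n (1 -
M) 𝓚` corresponds to `f ↦ (w + n + 1)⁻² f(1 / (w + n + 1))` (`laplace_opM_pow_mul`). Summing the
geometric series of `(1 - zM)⁻¹` gives the transfer operator for `|z| < 1`. But `(1 - zM)⁻¹` exists
on the whole cut plane, because `M` multiplies by values in `(0, 1)`; the conjugate `opQ z` of `opKz
z` is therefore the analytic continuation.

The kernel of `𝓚` is bounded and `m` is finite, so `𝓚` is Hilbert–Schmidt and a norm limit of
operators of finite rank (`exists_finiteRank_opK`). Thus `1 - opKz z` is an invertible operator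
minus one of finite rank, and its invertibility is decided by a determinant. This yields the
Fredholm alternative (`isUnit_one_sub_opKz_iff`) and the meromorphy of the resolvent
(`meromorphicAt_inverse_one_sub`).

In the unit disk `1` is not an eigenvalue: on `[0, 1]` the transfer operator contracts the norm `sup
(1 + x) |f x|`, whose weight is the reciprocal of the Gauss density, by the factor `|z|`
(`norm_laplace_opKz_le`). A fixed function vanishes on `[0, 1]`, hence everywhere by the identity
theorem.

If the resolvent had no pole at a point, its limit there would be a two-sided inverse
(`meromorphicOrderAt_inverse_neg_iff`), so the poles are exactly the points of non-invertibility. -/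

namespace FareyGauss

/-! ### Perturbation of an invertible operator by one of finite rank. -/

section FiniteRank

variable {E : Type*} [NormedAddCommGroup E] [NormedSpace ℂ E] {ι : Type*} [Fintype ι]

/-- The operator `x ↦ ∑ i j, N i j e_j(x) u_i` of finite rank. -/
noncomputable def finiteRankOp (e : ι → E →L[ℂ] ℂ) (u : ι → E) (N : Matrix ι ι ℂ) : E →L[ℂ] E :=
  ∑ i, ∑ j, N i j • (e j).smulRight (u i)

theorem finiteRankOp_apply (e : ι → E →L[ℂ] ℂ) (u : ι → E) (N : Matrix ι ι ℂ) (x : E) :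
    finiteRankOp e u N x = ∑ i, (N.mulVec fun j => e j x) i • u i := by
  simp only [finiteRankOp, sum_apply, smul_apply,
    ContinuousLinearMap.smulRight_apply, smul_smul, Matrix.mulVec, dotProduct, Finset.sum_smul]

theorem finiteRankOp_sub (e : ι → E →L[ℂ] ℂ) (u : ι → E) (N P : Matrix ι ι ℂ) :
    finiteRankOp e u (N - P) = finiteRankOp e u N - finiteRankOp e u P := by
  simp only [finiteRankOp, Matrix.sub_apply, sub_smul, Finset.sum_sub_distrib]

theorem finiteRankOp_zero (e : ι → E →L[ℂ] ℂ) (u : ι → E) : finiteRankOp e u 0 = 0 := by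
  simp [finiteRankOp]

/-- The compression `e_i(R u_j)` of an operator `R`. -/
noncomputable def compression (e : ι → E →L[ℂ] ℂ) (u : ι → E) (R : E →L[ℂ] E) : Matrix ι ι ℂ :=
  Matrix.of fun i j => e i (R (u j))

theorem apply_finiteRankOp (e : ι → E →L[ℂ] ℂ) (u : ι → E) (R : E →L[ℂ] E) (c : ι → ℂ) :
    (fun i => e i (R (∑ j, c j • u j))) = (compression e u R).mulVec c := by
  funext i
  simp [compression, Matrix.mulVec, dotProduct, map_sum, mul_comm]

theorem finiteRankOp_mul_mul (e : ι → E →L[ℂ] ℂ) (u : ι → E) (R : E →L[ℂ] E)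
    (P N : Matrix ι ι ℂ) :
    finiteRankOp e u P * R * finiteRankOp e u N =
      finiteRankOp e u (P * compression e u R * N) := by
  ext x
  rw [mul_apply_eq_comp, mul_apply_eq_comp, finiteRankOp_apply,
    finiteRankOp_apply, finiteRankOp_apply, apply_finiteRankOp]
  simp only [Matrix.mulVec_mulVec, Matrix.mul_assoc]

variable [DecidableEq ι]

/-- If the compressed matrix `1 - (e_i(R u_j))` is invertible, so is `R⁻¹ - ∑ e_i ⊗ u_i`. -/
theorem inverse_sub_finiteRankOp (e : ι → E →L[ℂ] ℂ) (u : ι → E) {A R : E →L[ℂ] E}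
    (hAR : A * R = 1) (hRA : R * A = 1) {N : Matrix ι ι ℂ}
    (h₁ : (1 - compression e u R) * N = 1) (h₂ : N * (1 - compression e u R) = 1) :
    (A - finiteRankOp e u 1) * (R + R * finiteRankOp e u N * R) = 1 ∧
      (R + R * finiteRankOp e u N * R) * (A - finiteRankOp e u 1) = 1 := by
  -- With `C` the compression, this is `1 + C N = N` read through `finiteRankOp_mul_mul`; `e₂` is `1
  -- + N C = N`. The inverse is the Woodbury formula.
  have e₁ : finiteRankOp e u 1 + finiteRankOp e u 1 * R * finiteRankOp e u N =
      finiteRankOp e u N := by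
    rw [finiteRankOp_mul_mul, ← sub_eq_zero, ← neg_eq_zero, neg_sub, ← sub_sub, ← finiteRankOp_sub,
      ← finiteRankOp_sub, ← finiteRankOp_zero e u, ← sub_eq_zero.2 h₁]
    congr 1
    noncomm_ring
  have e₂ : finiteRankOp e u 1 + finiteRankOp e u N * R * finiteRankOp e u 1 =
      finiteRankOp e u N := by
    rw [finiteRankOp_mul_mul, ← sub_eq_zero, ← neg_eq_zero, neg_sub, ← sub_sub, ← finiteRankOp_sub,
      ← finiteRankOp_sub, ← finiteRankOp_zero e u, ← sub_eq_zero.2 h₂]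
    congr 1
    noncomm_ring
  generalize finiteRankOp e u N = G at *
  generalize finiteRankOp e u 1 = F at *
  constructor
  · calc (A - F) * (R + R * G * R) = A * R + (A * R) * G * R - (F + F * R * G) * R := by noncomm_ring
      _ = 1 := by rw [hAR, e₁]; simp
  · calc (R + R * G * R) * (A - F) = R * A + R * G * (R * A) - R * (F + G * R * F) := by noncomm_ring
      _ = 1 := by rw [hRA, e₂]; simp

/-- If the compressed matrix is singular, then `R⁻¹ - ∑ e_i ⊗ u_i` has a kernel. -/
theorem exists_ker_of_det_eq_zero (e : ι → E →L[ℂ] ℂ) (u : ι → E) {A R : E →L[ℂ] E}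
    (hAR : A * R = 1) (h : (1 - compression e u R).det = 0) :
    ∃ x ≠ 0, (A - finiteRankOp e u 1) x = 0 := by
  obtain ⟨c, hc0, hc⟩ := Matrix.exists_mulVec_eq_zero_iff.2 h
  rw [Matrix.sub_mulVec, Matrix.one_mulVec, sub_eq_zero, ← apply_finiteRankOp] at hc
  -- A vector `c` fixed by the compression gives `x = R (∑ c_j u_j)` with `e_i(x) = c_i`; so `x ≠
  -- 0`, and both `A` and the finite-rank operator send `x` to `∑ c_j u_j`.
  refine ⟨R (∑ j, c j • u j), fun h0 => hc0 ?_, ?_⟩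
  · rw [hc]
    funext i
    simp [h0]
  · have h1 : A (R (∑ j, c j • u j)) = ∑ j, c j • u j :=
      congrArg (fun S : E →L[ℂ] E => S (∑ j, c j • u j)) hAR
    rw [sub_apply, h1, finiteRankOp_apply, Matrix.one_mulVec, sub_eq_zero]
    exact Finset.sum_congr rfl fun i _ => congrArg (· • u i) (congrFun hc i)

/-- The Fredholm alternative: the determinant of the compressed matrix either vanishes and yields a
fixed vector, or is nonzero and yields the inverse. -/
theorem isUnit_or_hasEigenvalue_one (e : ι → E →L[ℂ] ℂ) (u : ι → E) {T : E →L[ℂ] E}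
    (h : IsUnit (1 - (T - finiteRankOp e u 1))) :
    IsUnit (1 - T) ∨ Module.End.HasEigenvalue (T : E →ₗ[ℂ] E) 1 := by
  have hAR := Ring.mul_inverse_cancel _ h
  have hRA := Ring.inverse_mul_cancel _ h
  set A := 1 - (T - finiteRankOp e u 1) with hA
  have hT : 1 - T = A - finiteRankOp e u 1 := by rw [hA]; abel
  by_cases hd : (1 - compression e u (Ring.inverse A)).det = 0
  · right
    obtain ⟨x, hx0, hx⟩ := exists_ker_of_det_eq_zero e u hAR hd
    rw [← hT, sub_apply, sub_eq_zero] at hx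
    refine Module.End.hasEigenvalue_of_hasEigenvector (x := x) ⟨?_, hx0⟩
    rw [Module.End.mem_eigenspace_iff, one_smul]
    exact hx.symm
  · left
    have hu : IsUnit (1 - compression e u (Ring.inverse A)).det := isUnit_iff_ne_zero.2 hd
    obtain ⟨h1, h2⟩ := inverse_sub_finiteRankOp e u hAR hRA (Matrix.mul_nonsing_inv _ hu)
      (Matrix.nonsing_inv_mul _ hu)
    rw [hT]
    exact ⟨⟨_, _, h1, h2⟩, rfl⟩

theorem not_isUnit_of_hasEigenvalue_one {T : E →L[ℂ] E}
    (h : Module.End.HasEigenvalue (T : E →ₗ[ℂ] E) 1) : ¬ IsUnit (1 - T) := by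
  obtain ⟨x, hx⟩ := h.exists_hasEigenvector
  intro hu
  have h1 : T x = x := by simpa using hx.apply_eq_smul
  have h2 := congrArg (fun S : E →L[ℂ] E => S x) (Ring.inverse_mul_cancel _ hu)
  simp only [mul_apply_eq_comp, sub_apply,
    one_apply_eq_self, h1, sub_self, map_zero] at h2
  exact hx.2 h2.symm

theorem analyticAt_det {M : ℂ → Matrix ι ι ℂ} {z₀ : ℂ}
    (hM : ∀ i j, AnalyticAt ℂ (fun z => M z i j) z₀) : AnalyticAt ℂ (fun z => (M z).det) z₀ := by
  simp only [Matrix.det_apply']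
  exact Finset.analyticAt_fun_sum _ fun σ _ => analyticAt_const.mul
    (Finset.analyticAt_fun_prod _ fun i _ => hM _ _)

/-- An entry of the adjugate is a determinant with one row made constant. Through Cramer's rule the
only singular factor of the inverse matrix is the scalar `det⁻¹`. -/
theorem analyticAt_adjugate {M : ℂ → Matrix ι ι ℂ} {z₀ : ℂ}
    (hM : ∀ i j, AnalyticAt ℂ (fun z => M z i j) z₀) (i j : ι) :
    AnalyticAt ℂ (fun z => (M z).adjugate i j) z₀ := by
  simp only [Matrix.adjugate_apply]
  refine analyticAt_det fun k l => ?_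
  simp only [Matrix.updateRow_apply]
  split_ifs
  · exact analyticAt_const
  · exact hM k l

end FiniteRank

/-! ### The analytic Fredholm theorem and the poles of the resolvent. -/

section Fredholm

variable {E : Type*} [NormedAddCommGroup E] [NormedSpace ℂ E] [CompleteSpace E]
  {ι : Type*} [Fintype ι] [DecidableEq ι]

theorem analyticAt_inverse_one_sub_of_isUnit {T : ℂ → E →L[ℂ] E} {z₀ : ℂ} (hT : AnalyticAt ℂ T z₀)
    (h : IsUnit (1 - T z₀)) : AnalyticAt ℂ (fun z => Ring.inverse (1 - T z)) z₀ := by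
  have h1 : AnalyticAt ℂ (Ring.inverse : (E →L[ℂ] E) → _) (1 - T z₀) := by
    obtain ⟨v, hv⟩ := h
    rw [← hv]
    exact analyticAt_inverse v
  exact h1.comp_of_eq (analyticAt_const.sub hT) rfl

/-- The local form of the analytic Fredholm theorem. -/
theorem meromorphicAt_inverse_one_sub (e : ι → E →L[ℂ] ℂ) (u : ι → E) {T : ℂ → E →L[ℂ] E} {z₀ : ℂ}
    (hT : AnalyticAt ℂ T z₀) (h : IsUnit (1 - (T z₀ - finiteRankOp e u 1))) :
    MeromorphicAt (fun z => Ring.inverse (1 - T z)) z₀ := by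
  set F := finiteRankOp e u 1 with hF
  have hTF : AnalyticAt ℂ (fun z => T z - F) z₀ := hT.sub analyticAt_const
  set R : ℂ → E →L[ℂ] E := fun z => Ring.inverse (1 - (T z - F)) with hR
  have hRan : AnalyticAt ℂ R z₀ := analyticAt_inverse_one_sub_of_isUnit hTF h
  have hev : ∀ᶠ z in 𝓝 z₀, IsUnit (1 - (T z - F)) := by
    have hc : ContinuousAt (fun z => 1 - (T z - F)) z₀ := (analyticAt_const.sub hTF).continuousAt
    exact hc.eventually (Units.isOpen.mem_nhds h)
  set M : ℂ → Matrix ι ι ℂ := fun z => 1 - compression e u (R z) with hMdef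
  have hM : ∀ i j, AnalyticAt ℂ (fun z => M z i j) z₀ := by
    intro i j
    simp only [hMdef, Matrix.sub_apply, compression, Matrix.of_apply]
    refine analyticAt_const.sub ?_
    exact ((e i).comp (ContinuousLinearMap.apply ℂ E (u j))).analyticAt _ |>.comp_of_eq hRan rfl
  have hdet := analyticAt_det hM
  have hTA : ∀ z, 1 - T z = (1 - (T z - F)) - F := fun z => by abel
  rcases hdet.eventually_eq_zero_or_eventually_ne_zero with h0 | h0
  -- If the determinant vanishes identically near `z₀`, no `1 - T z` there is invertible and
  -- `Ring.inverse` takes its default value `0`.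
  · refine (MeromorphicAt.const (0 : E →L[ℂ] E) z₀).congr ?_
    refine Filter.Eventually.filter_mono nhdsWithin_le_nhds ?_
    filter_upwards [h0, hev] with z hz hzu
    rw [Ring.inverse_non_unit]
    obtain ⟨x, hx0, hx⟩ := exists_ker_of_det_eq_zero e u (Ring.mul_inverse_cancel _ hzu) hz
    intro hu
    rw [← hF, ← hTA] at hx
    have h2 := congrArg (fun S : E →L[ℂ] E => S x) (Ring.inverse_mul_cancel _ hu)
    simp only [mul_apply_eq_comp, hx, map_zero, one_apply_eq_self] at h2
    exact hx0 h2.symm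
  · have hG : AnalyticAt ℂ (fun z => R z * finiteRankOp e u (M z).adjugate * R z) z₀ := by
      refine (hRan.mul ?_).mul hRan
      unfold finiteRankOp
      exact Finset.analyticAt_fun_sum _ fun i _ => Finset.analyticAt_fun_sum _ fun j _ =>
        (analyticAt_adjugate hM i j).smul analyticAt_const
    have hmer : MeromorphicAt
        (fun z => R z + (M z).det⁻¹ • (R z * finiteRankOp e u (M z).adjugate * R z)) z₀ :=
      hRan.meromorphicAt.add (hdet.meromorphicAt.inv.smul hG.meromorphicAt)
    refine hmer.congr ?_
    filter_upwards [h0, hev.filter_mono nhdsWithin_le_nhds] with z hz hzu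
    have hu : IsUnit (M z).det := isUnit_iff_ne_zero.2 hz
    obtain ⟨h1, h2⟩ := inverse_sub_finiteRankOp e u (Ring.mul_inverse_cancel _ hzu)
      (Ring.inverse_mul_cancel _ hzu) (Matrix.mul_nonsing_inv (M z) hu)
      (Matrix.nonsing_inv_mul (M z) hu)
    rw [← hF, ← hTA] at h1 h2
    have h3 := Ring.inverse_unit (⟨_, _, h1, h2⟩ : (E →L[ℂ] E)ˣ)
    simp only at h3
    rw [h3]
    change _ = R z + R z * finiteRankOp e u (M z)⁻¹ * R z
    congr 1
    rw [Matrix.inv_def, Ring.inverse_eq_inv']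
    have : finiteRankOp e u ((M z).det⁻¹ • (M z).adjugate) =
        (M z).det⁻¹ • finiteRankOp e u (M z).adjugate := by
      simp only [finiteRankOp, Matrix.smul_apply, smul_eq_mul, mul_smul, Finset.smul_sum]
    rw [this, mul_smul_comm, smul_mul_assoc]

/-- A point is a pole of the resolvent `(1 - T z)⁻¹` if and only if `1 - T z` is not invertible
there, provided that the resolvent does not vanish identically near the point. -/
theorem meromorphicOrderAt_inverse_neg_iff {T : ℂ → E →L[ℂ] E} {z₀ : ℂ} (hT : AnalyticAt ℂ T z₀)
    (hmer : MeromorphicAt (fun z => Ring.inverse (1 - T z)) z₀)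
    (htop : meromorphicOrderAt (fun z => Ring.inverse (1 - T z)) z₀ ≠ ⊤) :
    meromorphicOrderAt (fun z => Ring.inverse (1 - T z)) z₀ < 0 ↔ ¬ IsUnit (1 - T z₀) := by
  constructor
  · intro h hu
    exact absurd (analyticAt_inverse_one_sub_of_isUnit hT hu).meromorphicOrderAt_nonneg (not_le.2 h)
  · contrapose!
    intro h
    -- Without a pole the resolvent has a limit `S`. Nearby it is nonzero, so it is a genuine
    -- inverse and not the default `0`; the two inverse identities pass to the limit.
    obtain ⟨S, hS⟩ := tendsto_nhds_of_meromorphicOrderAt_nonneg hmer h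
    have hc : Tendsto (fun z => 1 - T z) (𝓝[≠] z₀) (𝓝 (1 - T z₀)) :=
      ((analyticAt_const.sub hT).continuousAt (x := z₀)).tendsto.mono_left nhdsWithin_le_nhds
    have hev : ∀ᶠ z in 𝓝[≠] z₀, IsUnit (1 - T z) := by
      filter_upwards [(meromorphicOrderAt_ne_top_iff_eventually_ne_zero hmer).1 htop] with z hz
      by_contra hu
      exact hz (Ring.inverse_non_unit _ hu)
    have h1 : (1 - T z₀) * S = 1 := by
      refine tendsto_nhds_unique (hc.mul hS) (tendsto_const_nhds.congr' ?_)
      filter_upwards [hev] with z hz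
      exact (Ring.mul_inverse_cancel _ hz).symm
    have h2 : S * (1 - T z₀) = 1 := by
      refine tendsto_nhds_unique (hS.mul hc) (tendsto_const_nhds.congr' ?_)
      filter_upwards [hev] with z hz
      exact (Ring.inverse_mul_cancel _ hz).symm
    exact ⟨⟨_, _, h1, h2⟩, rfl⟩

end Fredholm

/-! ### Hilbert–Schmidt operators, and the case of `𝓚`. -/

section HilbertSchmidt

variable {E : Type*} [NormedAddCommGroup E] [InnerProductSpace ℂ E] {ι : Type*}

theorem finiteRankOp_one_apply {F : Type*} [NormedAddCommGroup F] [NormedSpace ℂ F] [Fintype ι]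
    [DecidableEq ι] (e : ι → F →L[ℂ] ℂ) (u : ι → F) (x : F) :
    finiteRankOp e u 1 x = ∑ i, e i x • u i := by
  rw [finiteRankOp_apply, Matrix.one_mulVec]

/-- An operator with `∑ ‖T b_i‖² < ∞` for a Hilbert basis `b` is a norm limit of operators of finite
rank. -/
theorem exists_finiteRankOp_norm_sub_le (b : HilbertBasis ι ℂ E) (T : E →L[ℂ] E)
    (h : Summable fun i => ‖T (b i)‖ ^ 2) {ε : ℝ} (hε : 0 < ε) :
    ∃ S : Finset ι, ∀ x, ‖T x - ∑ i ∈ S, inner ℂ (b i) x • T (b i)‖ ≤ ε * ‖x‖ := by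
  classical
  obtain ⟨S, hS⟩ := summable_iff_vanishing_norm.1 h (ε ^ 2) (by positivity)
  refine ⟨S, fun x => ?_⟩
  have hsum : HasSum (fun i => inner ℂ (b i) x • T (b i)) (T x) := by
    have := T.hasSum (b.hasSum_repr x)
    simpa [b.repr_apply_apply] using this
  have hlim : Tendsto (fun F : Finset ι => ‖∑ i ∈ F, inner ℂ (b i) x • T (b i) -
      ∑ i ∈ S, inner ℂ (b i) x • T (b i)‖) atTop
      (𝓝 ‖T x - ∑ i ∈ S, inner ℂ (b i) x • T (b i)‖) :=
    (Tendsto.sub hsum tendsto_const_nhds).norm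
  refine le_of_tendsto hlim ?_
  filter_upwards [eventually_ge_atTop S] with F hF
  -- Only indices outside `S` remain. Cauchy–Schwarz splits their sum into the tail of `∑ ‖T b_i‖²`,
  -- at most `ε²`, and Bessel's bound `‖x‖²`.
  rw [← Finset.sum_sdiff hF, add_sub_cancel_right]
  have h1 : ∑ i ∈ F \ S, ‖T (b i)‖ ^ 2 ≤ ε ^ 2 :=
    (le_abs_self _).trans (hS (F \ S) Finset.sdiff_disjoint).le
  have h2 : ∑ i ∈ F \ S, ‖inner ℂ (b i) x‖ ^ 2 ≤ ‖x‖ ^ 2 := b.orthonormal.sum_inner_products_le x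
  calc ‖∑ i ∈ F \ S, inner ℂ (b i) x • T (b i)‖
      ≤ ∑ i ∈ F \ S, ‖inner ℂ (b i) x‖ * ‖T (b i)‖ :=
        norm_sum_le_of_le _ fun i _ => (norm_smul _ _).le
    _ ≤ ε * ‖x‖ := by
        refine abs_le_of_sq_le_sq' ?_ (by positivity) |>.2
        refine (Finset.sum_mul_sq_le_sq_mul_sq _ _ _).trans ?_
        rw [mul_pow, mul_comm]
        gcongr

end HilbertSchmidt

theorem memLp_kernelK (t : ℝ) : MemLp (fun s => (kernelK s t : ℂ)) 2 m := by
  refine MemLp.of_bound ?_ 1 (.of_forall fun s => ?_)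
  · exact (Complex.measurable_ofReal.comp
      (measurable_kernelK.comp (measurable_id.prodMk measurable_const))).aestronglyMeasurable
  · rw [Complex.norm_real]; exact abs_kernelK_le s t

theorem norm_sq_eq_integral (φ : L2m) : ‖φ‖ ^ 2 = ∫ t, ‖φ t‖ ^ 2 ∂m := by
  have h := L2.inner_def (𝕜 := ℂ) φ φ
  simp only [inner_self_eq_norm_sq_to_K] at h
  have : (∫ t, ((‖φ t‖ : ℂ)) ^ 2 ∂m) = ((∫ t, ‖φ t‖ ^ 2 ∂m : ℝ) : ℂ) := by
    rw [← integral_complex_ofReal]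
    push_cast
    rfl
  simp only [Complex.coe_algebraMap] at h
  rw [this] at h
  exact_mod_cast h

theorem norm_toLp_kernelK_sq_le (t : ℝ) : ‖(memLp_kernelK t).toLp‖ ^ 2 ≤ m.real univ := by
  rw [norm_sq_eq_integral]
  calc ∫ s, ‖(memLp_kernelK t).toLp _ s‖ ^ 2 ∂m ≤ ∫ _, (1 : ℝ) ∂m := by
        refine integral_mono_of_nonneg (.of_forall fun _ => by positivity) (integrable_const _) ?_
        filter_upwards [(memLp_kernelK t).coeFn_toLp] with s hs
        rw [hs, Complex.norm_real, sq_le_one_iff₀ (norm_nonneg _)]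
        exact abs_kernelK_le s t
    _ = m.real univ := by simp

theorem inner_toLp_kernelK (φ : L2m) (t : ℝ) :
    inner ℂ (memLp_kernelK t).toLp φ = ∫ s : ℝ, (kernelK s t : ℂ) * φ s ∂m := by
  rw [L2.inner_def]
  refine integral_congr_ae ?_
  filter_upwards [(memLp_kernelK t).coeFn_toLp] with s hs
  rw [hs]
  simp [mul_comm]

/-- For almost every `t`, `(𝓚 b_i)(t)` is the inner product of `b_i` with the real kernel section at
`t`. Bessel's inequality bounds the sum over `i` of the squares by the squared norm of that section,
at most `m(ℝ)`; then integrate in `t`. -/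
theorem summable_norm_opK_sq {ι : Type*} (b : HilbertBasis ι ℂ L2m) :
    Summable fun i => ‖opK (b i)‖ ^ 2 := by
  refine summable_of_sum_le (c := m.real univ * m.real univ) (fun _ => by positivity) fun S => ?_
  simp only [norm_sq_eq_integral]
  have h_integrable : ∀ i, Integrable (fun t => ‖opK (b i) t‖ ^ 2) m := fun i =>
    (memLp_two_iff_integrable_sq_norm (Lp.aestronglyMeasurable _)).1 (Lp.memLp _)
  rw [← integral_finsetSum _ fun i _ => h_integrable i]
  calc ∫ t, ∑ i ∈ S, ‖opK (b i) t‖ ^ 2 ∂m ≤ ∫ _, m.real univ ∂m := by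
        refine integral_mono_ae (integrable_finsetSum _ fun i _ => h_integrable i) (integrable_const _) ?_
        have : ∀ᵐ t ∂m, ∀ i ∈ S, opK (b i) t = ∫ s : ℝ, (kernelK s t : ℂ) * b i s ∂m :=
          (Finset.eventually_all S).2 fun i _ => opK_apply_ae (b i)
        filter_upwards [this] with t ht
        refine le_trans ?_ (norm_toLp_kernelK_sq_le t)
        refine le_trans (Finset.sum_le_sum fun i hi => ?_)
          (b.orthonormal.sum_inner_products_le (memLp_kernelK t).toLp (s := S))
        rw [ht i hi, ← inner_toLp_kernelK, norm_inner_symm]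
    _ = m.real univ * m.real univ := by simp

/-- `𝓚` is a norm limit of operators of finite rank. -/
theorem exists_finiteRank_opK {ε : ℝ} (hε : 0 < ε) :
    ∃ (n : ℕ) (e : Fin n → L2m →L[ℂ] ℂ) (u : Fin n → L2m), ‖opK - finiteRankOp e u 1‖ ≤ ε := by
  obtain ⟨w, b, -⟩ := exists_hilbertBasis ℂ L2m
  obtain ⟨S, hS⟩ := exists_finiteRankOp_norm_sub_le b opK (summable_norm_opK_sq b) hε
  refine ⟨S.card, fun i => innerSL ℂ (b (S.equivFin.symm i)), fun i => opK (b (S.equivFin.symm i)),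
    ContinuousLinearMap.opNorm_le_bound _ hε.le fun x => ?_⟩
  rw [sub_apply, finiteRankOp_one_apply]
  have hsum : ∑ i, innerSL ℂ (b (S.equivFin.symm i)) x • opK (b (S.equivFin.symm i)) =
      ∑ i ∈ S, inner ℂ (b i) x • opK (b i) := by
    simp only [innerSL_apply_apply]
    rw [Equiv.sum_comp S.equivFin.symm (fun i : S => inner ℂ (b i) x • opK (b i))]
    exact Finset.sum_coe_sort S fun i => inner ℂ (b i) x • opK (b i)
  rw [hsum]
  exact hS x

/-! ### The multiplication operator `M`, its resolvent and the series for `𝓚_z`. -/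

theorem ae_m_of_forall_pos {p : ℝ → Prop} (h : ∀ t, 0 < t → p t) : ∀ᵐ t ∂m, p t :=
  (withDensity_absolutelyContinuous _ _).ae_le
    ((ae_restrict_iff' measurableSet_Ioi).2 (.of_forall fun t ht => h t ht))

theorem norm_opM_le : ‖opM‖ ≤ 1 := by
  refine ContinuousLinearMap.opNorm_le_bound _ zero_le_one fun φ => ?_
  rw [one_mul]
  refine Lp.norm_le_norm_of_ae_le ?_
  filter_upwards [opM_apply_ae φ, ae_m_of_forall_pos (p := (0 < ·)) fun _ h => h] with t ht h0
  rw [ht, norm_mul, Complex.norm_exp]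
  refine mul_le_of_le_one_left (norm_nonneg _) (Real.exp_le_one_iff.2 ?_)
  simpa using h0.le

theorem opM_pow_apply_ae (n : ℕ) (φ : L2m) :
    (opM ^ n) φ =ᵐ[m] fun t => Complex.exp (-(t : ℂ)) ^ n * φ t := by
  induction n with
  | zero => exact .of_forall fun t => by simp
  | succ n ih =>
    rw [pow_succ', mul_apply_eq_comp]
    filter_upwards [opM_apply_ae ((opM ^ n) φ), ih] with t h1 h2
    rw [h1, h2, pow_succ', mul_assoc]

theorem one_sub_opM_apply_ae (φ : L2m) :
    (1 - opM) φ =ᵐ[m] fun t => (1 - Complex.exp (-(t : ℂ))) * φ t := by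
  rw [sub_apply, one_apply_eq_self]
  filter_upwards [Lp.coeFn_sub φ (opM φ), opM_apply_ae φ] with t h1 h2
  rw [h1, Pi.sub_apply, h2, sub_mul, one_mul]

/-- A continuous positive function on the compact `[0, 1]` has a positive minimum; a zero `x` would
give `z = 1/x` on the cut. -/
theorem exists_le_norm_one_sub_mul {z : ℂ} (hz : z ∈ cutPlane) :
    ∃ δ > 0, ∀ x ∈ Icc (0 : ℝ) 1, δ ≤ ‖1 - z * x‖ := by
  obtain ⟨x₀, hx₀, hmin⟩ := isCompact_Icc.exists_isMinOn (nonempty_Icc.2 (zero_le_one' ℝ))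
    (f := fun x : ℝ => ‖1 - z * x‖) (by fun_prop)
  refine ⟨_, norm_pos_iff.2 fun h => ?_, fun x hx => hmin hx⟩
  have h1 : z * x₀ = 1 := (sub_eq_zero.1 h).symm
  have h0 : x₀ ≠ 0 := by rintro rfl; simp at h1
  have hpos : 0 < x₀ := lt_of_le_of_ne hx₀.1 h0.symm
  refine hz x₀⁻¹ ((one_le_inv₀ hpos).2 hx₀.2) ?_
  rw [Complex.ofReal_inv]
  exact eq_inv_of_mul_eq_one_left h1

/-- The inverse is multiplication by `(1 - z e^{-t})⁻¹`, which is bounded because `e^{-t}` lies in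
`[0, 1]`. -/
theorem isUnit_one_sub_smul_opM {z : ℂ} (hz : z ∈ cutPlane) : IsUnit (1 - z • opM) := by
  obtain ⟨δ, hδ, hb⟩ := exists_le_norm_one_sub_mul hz
  have hle : ∀ t : ℝ, 0 < t → δ ≤ ‖1 - z * Complex.exp (-(t : ℂ))‖ := by
    intro t ht
    have := hb (Real.exp (-t)) ⟨(Real.exp_pos _).le, Real.exp_le_one_iff.2 (by linarith)⟩
    rwa [Complex.ofReal_exp, Complex.ofReal_neg] at this
  have hg : MemLp (fun t : ℝ => (1 - z * Complex.exp (-(t : ℂ)))⁻¹) ∞ m := by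
    refine memLp_top_of_bound ?_ δ⁻¹ (ae_m_of_forall_pos fun t ht => ?_)
    · exact (by fun_prop : Measurable fun t : ℝ => (1 - z * Complex.exp (-(t : ℂ)))⁻¹)
        |>.aestronglyMeasurable
    · rw [norm_inv]
      exact inv_anti₀ hδ (hle t ht)
  set R : L2m →L[ℂ] L2m := (ContinuousLinearMap.mul ℂ ℂ).holderL m ∞ 2 2 hg.toLp
  have hR : ∀ φ : L2m, R φ =ᵐ[m] fun t => (1 - z * Complex.exp (-(t : ℂ)))⁻¹ * φ t := by
    intro φ
    refine ((ContinuousLinearMap.mul ℂ ℂ).coeFn_holder (r := 2) hg.toLp φ).trans ?_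
    filter_upwards [hg.coeFn_toLp] with t ht
    simp [ht]
  have hA : ∀ φ : L2m, (1 - z • opM) φ =ᵐ[m] fun t => (1 - z * Complex.exp (-(t : ℂ))) * φ t := by
    intro φ
    rw [sub_apply, one_apply_eq_self, smul_apply]
    filter_upwards [Lp.coeFn_sub φ (z • opM φ), Lp.coeFn_smul z (opM φ), opM_apply_ae φ]
      with t h1 h2 h3
    rw [h1, Pi.sub_apply, h2, Pi.smul_apply, h3, smul_eq_mul]
    ring
  have hne : ∀ᵐ t : ℝ ∂m, 1 - z * Complex.exp (-(t : ℂ)) ≠ 0 :=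
    ae_m_of_forall_pos fun t ht => norm_pos_iff.1 (hδ.trans_le (hle t ht))
  refine ⟨⟨1 - z • opM, R, ?_, ?_⟩, rfl⟩
  · ext φ
    rw [mul_apply_eq_comp, one_apply_eq_self]
    filter_upwards [hA (R φ), hR φ, hne] with t h1 h2 h3
    rw [h1, h2, mul_inv_cancel_left₀ h3]
  · ext φ
    rw [mul_apply_eq_comp, one_apply_eq_self]
    filter_upwards [hR ((1 - z • opM) φ), hA φ, hne] with t h1 h2 h3
    rw [h1, h2, inv_mul_cancel_left₀ h3]

theorem analyticAt_opKz {z : ℂ} (hz : z ∈ cutPlane) : AnalyticAt ℂ opKz z := by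
  have h1 : AnalyticAt ℂ (fun z : ℂ => Ring.inverse (1 - z • opM)) z :=
    analyticAt_inverse_one_sub_of_isUnit (T := fun z : ℂ => z • opM)
      (analyticAt_id.smul analyticAt_const) (isUnit_one_sub_smul_opM hz)
  exact analyticAt_id.smul ((analyticAt_const.mul h1).mul analyticAt_const)

/-- Neumann series, valid since `‖M‖ ≤ 1`. Because `1 - M` commutes with `M^n`, the `n`-th term
takes the form that matches `gaussBranch n`. -/
theorem opKz_hasSum {z : ℂ} (hz : ‖z‖ < 1) :
    HasSum (fun n : ℕ => z ^ (n + 1) • (opM ^ n * (1 - opM) * opK)) (opKz z) := by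
  have hlt : ‖z • opM‖ < 1 := by
    rw [norm_smul]
    exact (mul_le_of_le_one_right (norm_nonneg _) norm_opM_le).trans_lt hz
  have h1 : HasSum (fun n : ℕ => (z • opM) ^ n) (Ring.inverse (1 - z • opM)) := by
    rw [NormedRing.inverse_one_sub _ hlt]
    exact (summable_geometric_of_norm_lt_one hlt).hasSum
  have h2 := (((h1.mul_left (1 - opM)).mul_right opK).const_smul z)
  have h3 : (fun n : ℕ => z ^ (n + 1) • (opM ^ n * (1 - opM) * opK)) =
      fun n => z • ((1 - opM) * (z • opM) ^ n * opK) := by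
    funext n
    have hc : (1 - opM) * opM ^ n = opM ^ n * (1 - opM) :=
      ((Commute.one_left _).sub_left ((Commute.refl opM).pow_right n)).eq
    rw [smul_pow, mul_smul_comm, hc, smul_mul_assoc, smul_smul, pow_succ']
  rw [h3]
  exact h2

/-! ### Laplace integrals of the Bessel kernel and the intertwining with the Gauss branches. -/

theorem integrableOn_pow_mul_cexp (k : ℕ) {u : ℂ} (hu : 0 < u.re) :
    IntegrableOn (fun t : ℝ => (t : ℂ) ^ k * Complex.exp (-u * t)) (Ioi 0) := by
  have h := integrableOn_rpow_mul_exp_neg_mul_rpow (p := 1) (s := k) (b := u.re)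
    (by have : (0 : ℝ) ≤ k := k.cast_nonneg
        linarith) one_pos hu
  refine Integrable.mono' h (by fun_prop) ?_
  refine (ae_restrict_iff' measurableSet_Ioi).2 (.of_forall fun t ht => ?_)
  have ht : 0 < t := ht
  rw [norm_mul, norm_pow, Complex.norm_real, Complex.norm_exp, Real.norm_of_nonneg ht.le]
  simp

theorem integral_pow_mul_cexp (k : ℕ) {u : ℂ} (hu : 0 < u.re) :
    ∫ t : ℝ in Ioi 0, (t : ℂ) ^ k * Complex.exp (-u * t) = k.factorial / u ^ (k + 1) := by
  have hu0 : u ≠ 0 := by rintro rfl; simp at hu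
  induction k with
  | zero =>
    have := integral_exp_mul_complex_Ioi (a := -u) (by simpa using hu) 0
    simpa using this
  | succ k ih =>
    have hd : ∀ t ∈ Ici (0 : ℝ), HasDerivAt (fun t : ℝ => (t : ℂ) ^ (k + 1) * Complex.exp (-u * t))
        ((k + 1) * ((t : ℂ) ^ k * Complex.exp (-u * t)) -
          u * ((t : ℂ) ^ (k + 1) * Complex.exp (-u * t))) t := by
      intro t _
      have h1 : HasDerivAt (fun t : ℂ => t ^ (k + 1) * Complex.exp (-u * t))
          ((k + 1) * ((t : ℂ) ^ k * Complex.exp (-u * t)) -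
          u * ((t : ℂ) ^ (k + 1) * Complex.exp (-u * t))) t := by
        refine ((hasDerivAt_pow (k + 1) (t : ℂ)).mul
          (((hasDerivAt_id (t : ℂ)).const_mul (-u)).cexp)).congr_deriv ?_
        simp
        ring
      exact h1.comp_ofReal
    have h_integrable := ((integrableOn_pow_mul_cexp k hu).const_mul (k + 1 : ℂ)).sub
      ((integrableOn_pow_mul_cexp (k + 1) hu).const_mul u)
    have hlim : Tendsto (fun t : ℝ => (t : ℂ) ^ (k + 1) * Complex.exp (-u * t)) atTop (𝓝 0) := by
      rw [tendsto_zero_iff_norm_tendsto_zero]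
      have := tendsto_rpow_mul_exp_neg_mul_atTop_nhds_zero (k + 1 : ℕ) u.re hu
      refine this.congr' ?_
      filter_upwards [eventually_gt_atTop 0] with t ht
      rw [norm_mul, norm_pow, Complex.norm_real, Complex.norm_exp, Real.norm_of_nonneg ht.le,
        Real.rpow_natCast]
      simp
    have h := integral_Ioi_of_hasDerivAt_of_tendsto' hd h_integrable hlim
    rw [integral_sub ((integrableOn_pow_mul_cexp k hu).const_mul _)
      ((integrableOn_pow_mul_cexp (k + 1) hu).const_mul _), integral_const_mul,
      integral_const_mul, ih] at h
    simp only [Complex.ofReal_zero, ne_eq, Nat.add_eq_zero_iff, one_ne_zero, and_false,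
      not_false_eq_true, zero_pow, zero_mul, sub_zero] at h
    rw [sub_eq_zero] at h
    rw [eq_div_iff (pow_ne_zero _ hu0), Nat.factorial_succ, pow_succ', ← mul_assoc, mul_comm _ u,
      ← h, Nat.cast_mul, Nat.cast_succ, mul_assoc, div_mul_cancel₀ _ (pow_ne_zero _ hu0)]

/-- `∫ e^{-ut} t c₁(st) dt = e^{-s/u} / u²`. -/
theorem integral_cexp_mul_besselC {s : ℝ} (hs : 0 ≤ s) {u : ℂ} (hu : 0 < u.re) :
    ∫ t : ℝ in Ioi 0, Complex.exp (-u * t) * t * (besselC 1 (s * t) : ℂ) =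
      (1 / u) ^ 2 * Complex.exp (-(s : ℂ) * (1 / u)) := by
  have hu0 : u ≠ 0 := by rintro rfl; simp at hu
  have hur : 0 < ((u.re : ℝ) : ℂ).re := hu
  set c : ℕ → ℂ := fun k => (-(s : ℂ)) ^ k / ((k.factorial : ℂ) * ((k + 1).factorial : ℂ)) with hc
  set F : ℕ → ℝ → ℂ := fun k t => c k * ((t : ℂ) ^ (k + 1) * Complex.exp (-u * t)) with hF
  have hFint : ∀ k, Integrable (F k) (volume.restrict (Ioi 0)) := fun k =>
    (integrableOn_pow_mul_cexp (k + 1) hu).const_mul _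
  have hFnorm : ∀ k, ∫ t in Ioi 0, ‖F k t‖ = (1 / u.re) ^ 2 * ((s / u.re) ^ k / k.factorial) := by
    intro k
    -- The norm has the same shape with `u` replaced by `u.re`; the cast to `ℂ` lets
    -- `integral_pow_mul_cexp` evaluate it. The resulting exponential series justifies integrating
    -- the expansion of `besselC 1` term by term.
    have h1 : ∀ t ∈ Ioi (0 : ℝ), ((‖F k t‖ : ℝ) : ℂ) =
        (‖c k‖ : ℂ) * ((t : ℂ) ^ (k + 1) * Complex.exp (-(u.re : ℂ) * t)) := by
      intro t ht
      have ht : 0 < t := ht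
      simp only [hF]
      rw [norm_mul, norm_mul, norm_pow, Complex.norm_real, Complex.norm_exp,
        Real.norm_of_nonneg ht.le]
      push_cast
      simp
    have h2 := setIntegral_congr_fun (μ := volume) measurableSet_Ioi h1
    rw [integral_complex_ofReal, integral_const_mul, integral_pow_mul_cexp _ hur] at h2
    have h3 : ‖c k‖ = s ^ k / ((k.factorial : ℝ) * ((k + 1).factorial : ℝ)) := by
      simp only [hc]
      rw [norm_div, norm_mul, norm_pow, norm_neg, Complex.norm_real, Real.norm_of_nonneg hs,
        Complex.norm_natCast, Complex.norm_natCast]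
    rw [h3] at h2
    have h4 : ((k + 1).factorial : ℝ) ≠ 0 := by exact_mod_cast Nat.factorial_ne_zero _
    have h5 : (k.factorial : ℝ) ≠ 0 := by exact_mod_cast Nat.factorial_ne_zero _
    have h6 : ∫ t in Ioi 0, ‖F k t‖ = s ^ k / ((k.factorial : ℝ) * ((k + 1).factorial : ℝ)) *
        (((k + 1).factorial : ℝ) / u.re ^ (k + 1 + 1)) := by exact_mod_cast h2
    rw [h6, div_pow s]
    field_simp
    ring
  have hsum : Summable fun k => ∫ t in Ioi 0, ‖F k t‖ := by
    simp only [hFnorm]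
    exact (Real.summable_pow_div_factorial _).mul_left _
  have key := hasSum_integral_of_summable_integral_norm hFint hsum
  have hlhs : ∫ t in Ioi 0, ∑' k, F k t =
      ∫ t : ℝ in Ioi 0, Complex.exp (-u * t) * t * (besselC 1 (s * t) : ℂ) := by
    refine integral_congr_ae (.of_forall fun t => ?_)
    simp only [besselC, hF, hc]
    rw [Complex.ofReal_tsum, ← tsum_mul_left]
    refine tsum_congr fun k => ?_
    push_cast
    rw [show -((s : ℂ) * t) = -(s : ℂ) * t by ring, mul_pow]
    ring
  rw [hlhs] at key
  refine key.unique ?_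
  have hexp := NormedSpace.expSeries_div_hasSum_exp (-(s : ℂ) * (1 / u))
  rw [← Complex.exp_eq_exp_ℂ] at hexp
  have hterm : (fun k => ∫ t in Ioi 0, F k t) =
      fun k => (1 / u) ^ 2 * ((-(s : ℂ) * (1 / u)) ^ k / k.factorial) := by
    funext k
    have h4 : ((k + 1).factorial : ℂ) ≠ 0 := by exact_mod_cast Nat.factorial_ne_zero _
    have h5 : (k.factorial : ℂ) ≠ 0 := by exact_mod_cast Nat.factorial_ne_zero _
    simp only [hF, hc]
    rw [integral_const_mul, integral_pow_mul_cexp _ hu, mul_pow, div_pow 1 u k, one_pow]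
    field_simp
    ring
  rw [hterm]
  exact hexp.mul_left ((1 / u) ^ 2)

theorem kernelK_eq {s t : ℝ} (hs : 0 < s) (ht : 0 < t) : kernelK s t = besselC 1 (s * t) := by
  have h : 0 < √(s * t) := Real.sqrt_pos.2 (mul_pos hs ht)
  unfold kernelK
  rw [besselJ_eq, mul_pow, Real.sq_sqrt (mul_pos hs ht).le,
    show (2 : ℝ) ^ 2 * (s * t) / 4 = s * t by ring, pow_one]
  field_simp

theorem integral_m_eq (f : ℝ → ℂ) : ∫ t, f t ∂m = ∫ t in Ioi 0, (mDensity t : ℂ) * f t := by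
  unfold m
  rw [integral_withDensity_eq_integral_toReal_smul measurable_mDensity.ennreal_ofReal (by simp)]
  refine setIntegral_congr_fun measurableSet_Ioi fun t ht => ?_
  rw [ENNReal.toReal_ofReal (mDensity_nonneg ht), Complex.real_smul]

/-- This cancellation is why `𝓚_z` contains the factor `1 - M`; the leftover `e^{-t}` shifts `w + n`
to `w + n + 1`. -/
theorem mDensity_mul_one_sub_cexp {t : ℝ} (ht : 0 < t) :
    (mDensity t : ℂ) * (1 - Complex.exp (-(t : ℂ))) = t * Complex.exp (-(t : ℂ)) := by
  have h1 : Real.exp t - 1 ≠ 0 := by linarith [Real.add_one_lt_exp ht.ne']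
  have : mDensity t * (1 - Real.exp (-t)) = t * Real.exp (-t) := by
    unfold mDensity
    rw [Real.exp_neg]
    have := Real.exp_ne_zero t
    field_simp
  rw [← Complex.ofReal_neg, ← Complex.ofReal_exp]
  exact_mod_cast this

theorem add_natCast_succ_re_pos (n : ℕ) (w : HalfPlane) : 0 < (w.1 + (n + 1 : ℕ)).re := by
  have := w.2
  have hn : (0 : ℝ) ≤ n := n.cast_nonneg
  simp only [Complex.add_re, Complex.natCast_re]
  push_cast
  linarith

theorem integral_mul_kernelK {s : ℝ} (hs : 0 < s) (n : ℕ) (w : HalfPlane) :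
    ∫ t : ℝ, Complex.exp (-(t : ℂ) * w.1) * (Complex.exp (-(t : ℂ)) ^ n *
      (1 - Complex.exp (-(t : ℂ)))) * kernelK s t ∂m =
    (1 / (w.1 + (n + 1 : ℕ))) ^ 2 * Complex.exp (-(s : ℂ) * (1 / (w.1 + (n + 1 : ℕ)))) := by
  rw [← integral_cexp_mul_besselC hs.le (add_natCast_succ_re_pos n w), integral_m_eq]
  refine setIntegral_congr_fun measurableSet_Ioi fun t ht => ?_
  have ht : 0 < t := ht
  rw [kernelK_eq hs ht]
  have h1 : Complex.exp (-(w.1 + (n + 1 : ℕ)) * t) =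
      Complex.exp (-(t : ℂ) * w.1) * Complex.exp (-(t : ℂ)) ^ n * Complex.exp (-(t : ℂ)) := by
    rw [← Complex.exp_nat_mul, ← Complex.exp_add, ← Complex.exp_add]
    push_cast
    ring_nf
  rw [h1]
  linear_combination Complex.exp (-(t : ℂ) * w.1) * Complex.exp (-(t : ℂ)) ^ n *
    (besselC 1 (s * t) : ℂ) * mDensity_mul_one_sub_cexp ht

theorem integrable_cexp_mul (n : ℕ) (w : HalfPlane) :
    Integrable (fun t : ℝ => Complex.exp (-(t : ℂ) * w.1) * (Complex.exp (-(t : ℂ)) ^ n *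
      (1 - Complex.exp (-(t : ℂ))))) m := by
  refine Integrable.mul_bdd (c := 2) ((memLp_cexp w).integrable (by norm_num)) (by fun_prop)
    (ae_m_of_forall_pos fun t ht => ?_)
  have h1 : ‖Complex.exp (-(t : ℂ))‖ ≤ 1 := by
    rw [Complex.norm_exp]
    exact Real.exp_le_one_iff.2 (by simpa using ht.le)
  rw [norm_mul, norm_pow]
  calc ‖Complex.exp (-(t : ℂ))‖ ^ n * ‖1 - Complex.exp (-(t : ℂ))‖ ≤ 1 * (1 + 1) := by
        gcongr
        · exact pow_le_one₀ (norm_nonneg _) h1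
        · refine (norm_sub_le _ _).trans ?_
          rw [norm_one]
          gcongr
    _ = 2 := by norm_num

/-- Fubini moves the `t`-integral inside, where `integral_mul_kernelK` evaluates it to a multiple of
`e^{-s/(w+n+1)}`; the remaining `s`-integral is the Laplace transform at the image point. -/
theorem laplace_opM_pow_mul (n : ℕ) (φ : L2m) (w : HalfPlane) :
    laplace ((opM ^ n * (1 - opM) * opK) φ) w =
      (1 / (w.1 + (n + 1 : ℕ))) ^ 2 * laplace φ (gaussBranch n w) := by
  set a : ℝ → ℂ := fun t => Complex.exp (-(t : ℂ) * w.1) * (Complex.exp (-(t : ℂ)) ^ n *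
      (1 - Complex.exp (-(t : ℂ)))) with ha
  have hφ : Integrable φ m := (Lp.memLp φ).integrable (by norm_num)
  have hswap : Integrable (Function.uncurry fun t s : ℝ => a t * φ s * (kernelK s t : ℂ))
      (m.prod m) := by
    refine Integrable.mul_bdd (c := 1) ((integrable_cexp_mul n w).mul_prod hφ) ?_
      (.of_forall fun q => ?_)
    · exact (Complex.measurable_ofReal.comp
        (measurable_kernelK.comp measurable_swap)).aestronglyMeasurable
    · rw [Complex.norm_real]
      exact abs_kernelK_le _ _
  calc laplace ((opM ^ n * (1 - opM) * opK) φ) w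
      = ∫ t : ℝ, (∫ s : ℝ, a t * φ s * (kernelK s t : ℂ) ∂m) ∂m := by
        refine integral_congr_ae ?_
        rw [mul_apply_eq_comp, mul_apply_eq_comp]
        filter_upwards [opM_pow_apply_ae n ((1 - opM) (opK φ)), one_sub_opM_apply_ae (opK φ),
          opK_apply_ae φ] with t h1 h2 h3
        rw [h1, h2, h3]
        simp only [ha]
        rw [← mul_assoc, ← mul_assoc, ← integral_const_mul]
        refine integral_congr_ae (.of_forall fun s => ?_)
        simp only
        ring
    _ = ∫ s : ℝ, (∫ t : ℝ, a t * φ s * (kernelK s t : ℂ) ∂m) ∂m := integral_integral_swap hswap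
    _ = ∫ s : ℝ, (1 / (w.1 + (n + 1 : ℕ))) ^ 2 *
          (Complex.exp (-(s : ℂ) * (1 / (w.1 + (n + 1 : ℕ)))) * φ s) ∂m := by
        refine integral_congr_ae ?_
        refine ae_m_of_forall_pos fun s hs => ?_
        simp only
        rw [← mul_assoc, ← integral_mul_kernelK hs n w, ← integral_mul_const]
        refine integral_congr_ae (.of_forall fun t => ?_)
        simp only [ha]
        ring
    _ = _ := integral_const_mul _ _

/-- The evaluation `φ ↦ 𝓛[φ](w)` as a continuous functional. -/
theorem laplace_eq_inner (φ : L2m) (w : HalfPlane) :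
    laplace φ w = inner ℂ (memLp_cexp ⟨(starRingEnd ℂ) w.1, by simpa using w.2⟩).toLp φ := by
  rw [L2.inner_def]
  refine integral_congr_ae ?_
  filter_upwards [(memLp_cexp ⟨(starRingEnd ℂ) w.1, by simpa using w.2⟩).coeFn_toLp] with t ht
  rw [ht]
  simp [← Complex.exp_conj, mul_comm]

theorem hasSum_laplace {f : ℕ → L2m} {φ : L2m} (h : HasSum f φ) (w : HalfPlane) :
    HasSum (fun n => laplace (f n) w) (laplace φ w) := by
  simp only [laplace_eq_inner]
  exact (innerSL ℂ _).hasSum h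

theorem hasSum_laplace_opKz {z : ℂ} (hz : ‖z‖ < 1) (φ : L2m) (w : HalfPlane) :
    HasSum (fun n : ℕ => z ^ (n + 1) * (1 / (w.1 + (n + 1 : ℕ))) ^ 2 *
      laplace φ (gaussBranch n w)) (laplace (opKz z φ) w) := by
  have h := hasSum_laplace ((ContinuousLinearMap.apply ℂ L2m φ).hasSum (opKz_hasSum hz)) w
  have hterm : (fun n : ℕ => z ^ (n + 1) * (1 / (w.1 + (n + 1 : ℕ))) ^ 2 *
      laplace φ (gaussBranch n w)) = fun n : ℕ => laplace (ContinuousLinearMap.apply ℂ L2m φ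
        (z ^ (n + 1) • (opM ^ n * (1 - opM) * opK))) w := by
    funext n
    rw [ContinuousLinearMap.apply_apply, smul_apply, map_smul, Pi.smul_apply, smul_eq_mul,
      laplace_opM_pow_mul, mul_assoc]
  rw [hterm]
  exact h

/-! ### No eigenvalue `1` in the unit disk. -/

/-- A nonnegative real number as a point of the half-plane. -/
def realPoint (x : ℝ) (hx : 0 ≤ x) : HalfPlane := ⟨x, by simp; linarith⟩

theorem gaussBranch_realPoint (n : ℕ) {x : ℝ} (hx : 0 ≤ x) :
    gaussBranch n (realPoint x hx) = realPoint (1 / (x + (n + 1))) (by positivity) := by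
  refine Subtype.ext ?_
  simp [gaussBranch, realPoint]

theorem norm_laplace_realPoint_le (φ : L2m) {x : ℝ} (hx : 0 ≤ x) :
    ‖laplace φ (realPoint x hx)‖ ≤ ∫ t, ‖φ t‖ ∂m := by
  have hφ : Integrable φ m := (Lp.memLp φ).integrable (by norm_num)
  refine norm_integral_le_of_norm_le hφ.norm (ae_m_of_forall_pos fun t ht => ?_)
  rw [norm_mul, Complex.norm_exp]
  refine mul_le_of_le_one_left (norm_nonneg _) (Real.exp_le_one_iff.2 ?_)
  simp only [realPoint, ← Complex.ofReal_neg, ← Complex.ofReal_mul, Complex.ofReal_re]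
  nlinarith

/-- The weighted supremum norm `sup (1 + x) |f x|` over `[0, 1]` is contracted by `𝓠_z`. -/
theorem norm_laplace_opKz_le {z : ℂ} (hz : ‖z‖ < 1) (φ : L2m) {C : ℝ}
    (hC : ∀ (x : ℝ) (hx : 0 ≤ x), x ≤ 1 → (1 + x) * ‖laplace φ (realPoint x hx)‖ ≤ C)
    {x : ℝ} (hx : 0 ≤ x) :
    (1 + x) * ‖laplace (opKz z φ) (realPoint x hx)‖ ≤ ‖z‖ * C := by
  have hC0 : 0 ≤ C := le_trans (by positivity) (hC 0 le_rfl zero_le_one)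
  have hlim := (hasSum_laplace_opKz hz φ (realPoint x hx)).tendsto_sum_nat.norm
  have hle : ‖laplace (opKz z φ) (realPoint x hx)‖ ≤ ‖z‖ * C * (1 / (x + 1)) := by
    refine le_of_tendsto hlim (.of_forall fun N => ?_)
    -- With `y = x + n + 1` the weight gives `y⁻² / (1 + 1/y) = 1/y - 1/(y + 1)`, so the sum
    -- telescopes to `1/(x + 1)`: the Gauss density is invariant at `z = 1`.
    have hterm : ∀ n : ℕ, ‖z ^ (n + 1) * (1 / ((realPoint x hx).1 + (n + 1 : ℕ))) ^ 2 *
        laplace φ (gaussBranch n (realPoint x hx))‖ ≤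
        ‖z‖ * C * (1 / (x + ((n : ℕ) + 1)) - 1 / (x + ((n + 1 : ℕ) + 1))) := by
      intro n
      have hn : (0 : ℝ) ≤ n := n.cast_nonneg
      set y : ℝ := x + (n + 1) with hy
      have hy1 : 1 ≤ y := by linarith
      have hy0 : 0 < y := by linarith
      have h1 : ((realPoint x hx).1 + (n + 1 : ℕ) : ℂ) = (y : ℂ) := by
        simp [realPoint, hy]
      have h2 : ‖laplace φ (gaussBranch n (realPoint x hx))‖ ≤ C / (1 + 1 / y) := by
        rw [gaussBranch_realPoint, le_div_iff₀' (by positivity)]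
        exact hC (1 / y) (by positivity) ((div_le_one hy0).2 hy1)
      have h3 : ‖z ^ (n + 1)‖ ≤ ‖z‖ := by
        rw [norm_pow]
        exact pow_le_of_le_one (norm_nonneg _) hz.le (by omega)
      have h4 : ‖(1 / (y : ℂ)) ^ 2‖ = (1 / y) ^ 2 := by
        rw [norm_pow, norm_div, norm_one, Complex.norm_real, Real.norm_of_nonneg hy0.le]
      rw [norm_mul, norm_mul, h1, h4]
      calc ‖z ^ (n + 1)‖ * (1 / y) ^ 2 * ‖laplace φ (gaussBranch n (realPoint x hx))‖
          ≤ ‖z‖ * (1 / y) ^ 2 * (C / (1 + 1 / y)) := by gcongr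
        _ = ‖z‖ * C * (1 / y - 1 / (x + ((n + 1 : ℕ) + 1))) := by
          have : x + (((n + 1 : ℕ) : ℝ) + 1) = y + 1 := by rw [hy]; push_cast; ring
          rw [this]
          field_simp
          ring
    refine (norm_sum_le_of_le _ fun n _ => hterm n).trans ?_
    rw [← Finset.mul_sum, Finset.sum_range_sub' (fun n : ℕ => 1 / (x + ((n : ℝ) + 1)))]
    gcongr
    have : 0 ≤ 1 / (x + ((N : ℝ) + 1)) := by positivity
    simp only [Nat.cast_zero, zero_add]
    linarith
  calc (1 + x) * ‖laplace (opKz z φ) (realPoint x hx)‖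
      ≤ (1 + x) * (‖z‖ * C * (1 / (x + 1))) := by gcongr
    _ = ‖z‖ * C := by field_simp; ring

/-- Iterating the contraction on a fixed function bounds its weighted norm by `|z|^N B` for every
`N`. -/
theorem laplace_eq_zero_of_fixed {z : ℂ} (hz : ‖z‖ < 1) {φ : L2m} (h : opKz z φ = φ)
    {x : ℝ} (hx : 0 ≤ x) (hx1 : x ≤ 1) : laplace φ (realPoint x hx) = 0 := by
  set B : ℝ := 2 * ∫ t, ‖φ t‖ ∂m with hB
  have key : ∀ N : ℕ, ∀ (x : ℝ) (hx : 0 ≤ x), x ≤ 1 →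
      (1 + x) * ‖laplace φ (realPoint x hx)‖ ≤ ‖z‖ ^ N * B := by
    intro N
    induction N with
    | zero =>
      intro x hx hx1
      rw [pow_zero, one_mul]
      exact mul_le_mul (by linarith) (norm_laplace_realPoint_le φ hx) (norm_nonneg _) zero_le_two
    | succ N ih =>
      intro x hx hx1
      have := norm_laplace_opKz_le hz φ ih hx
      rwa [h, ← mul_assoc, ← pow_succ'] at this
  have hlim : Tendsto (fun N : ℕ => ‖z‖ ^ N * B) atTop (𝓝 0) := by
    simpa using (tendsto_pow_atTop_nhds_zero_of_lt_one (norm_nonneg z) hz).mul_const B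
  have h0 := ge_of_tendsto' hlim fun N => key N x hx hx1
  have h1 : ‖laplace φ (realPoint x hx)‖ ≤ 0 := by
    by_contra hpos
    push Not at hpos
    nlinarith
  exact norm_le_zero_iff.1 h1

theorem differentiableOn_laplace (φ : L2m) :
    DifferentiableOn ℂ (fun w : ℂ => ∫ t : ℝ, Complex.exp (-(t : ℂ) * w) * φ t ∂m)
      {w | -(1 / 2) < w.re} := by
  intro w₀ hw₀
  have hw₀ : -(1 / 2) < w₀.re := hw₀
  -- A quarter of the distance to the boundary: one `ε` is lost on the ball, another on `t ≤ ε⁻¹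
  -- e^{εt}` for the factor `t` of the derivative, and `w₀.re - 2ε` still exceeds `-1/2`.
  set ε : ℝ := (w₀.re + 1 / 2) / 4 with hε
  have hε0 : 0 < ε := by rw [hε]; linarith
  have hmeas : ∀ w : ℂ, AEStronglyMeasurable (fun t : ℝ => Complex.exp (-(t : ℂ) * w) * φ t) m :=
    fun w => AEStronglyMeasurable.mul (by fun_prop) (Lp.aestronglyMeasurable φ)
  have hbd := ((integrable_laplace ⟨((w₀.re - 2 * ε : ℝ) : ℂ), by
    rw [Complex.ofReal_re]; linarith⟩ φ).norm).const_mul ε⁻¹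
  have h := hasDerivAt_integral_of_dominated_loc_of_deriv_le (μ := m) (𝕜 := ℂ)
    (F := fun (w : ℂ) (t : ℝ) => Complex.exp (-(t : ℂ) * w) * φ t)
    (F' := fun (w : ℂ) (t : ℝ) => Complex.exp (-(t : ℂ) * w) * (-(t : ℂ)) * φ t)
    (x₀ := w₀) (Metric.ball_mem_nhds w₀ hε0) (.of_forall hmeas)
    (integrable_laplace ⟨w₀, hw₀⟩ φ)
    (AEStronglyMeasurable.mul (by fun_prop) (Lp.aestronglyMeasurable φ)) ?_ hbd
    (.of_forall fun t w _ => ?_)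
  · exact h.2.differentiableAt.differentiableWithinAt
  · refine ae_m_of_forall_pos fun t ht w hw => ?_
    have hre : w₀.re - ε ≤ w.re := by
      have h1 : |(w - w₀).re| ≤ ‖w - w₀‖ := Complex.abs_re_le_norm _
      have h2 : ‖w - w₀‖ < ε := by simpa [dist_eq_norm] using hw
      have h3 := abs_le.1 (h1.trans h2.le)
      rw [Complex.sub_re] at h3
      linarith [h3.1]
    have h1 : t ≤ ε⁻¹ * Real.exp (ε * t) := by
      rw [inv_mul_eq_div, le_div_iff₀ hε0]
      nlinarith [Real.add_one_le_exp (ε * t)]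
    have h2 : (-(t : ℂ) * w).re = -t * w.re := by simp
    have h3 : (-(t : ℂ) * ((w₀.re - 2 * ε : ℝ) : ℂ)).re = -t * (w₀.re - 2 * ε) := by
      rw [← Complex.ofReal_neg, ← Complex.ofReal_mul, Complex.ofReal_re]
    rw [norm_mul, norm_mul, norm_mul, norm_neg, Complex.norm_real, Real.norm_of_nonneg ht.le,
      Complex.norm_exp, Complex.norm_exp, h2, h3, ← mul_assoc]
    refine mul_le_mul_of_nonneg_right ?_ (norm_nonneg _)
    calc Real.exp (-t * w.re) * t ≤ Real.exp (-t * (w₀.re - ε)) * (ε⁻¹ * Real.exp (ε * t)) := by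
          gcongr ?_ * ?_
          exact Real.exp_le_exp.2 (by nlinarith)
      _ = ε⁻¹ * Real.exp (-t * (w₀.re - 2 * ε)) := by
          rw [mul_left_comm, ← Real.exp_add]
          ring_nf
  · have h1 : HasDerivAt (fun w : ℂ => -(t : ℂ) * w) (-(t : ℂ)) w := by
      simpa using (hasDerivAt_id w).const_mul (-(t : ℂ))
    exact h1.cexp.mul_const _

/-- The identity theorem on the half-plane, with zeros accumulating at the interior point `1/2`,
followed by injectivity of the transform. -/
theorem eq_zero_of_laplace_realPoint_eq_zero {φ : L2m}
    (h : ∀ (x : ℝ) (hx : 0 ≤ x), x ≤ 1 → laplace φ (realPoint x hx) = 0) : φ = 0 := by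
  set F : ℂ → ℂ := fun w => ∫ t : ℝ, Complex.exp (-(t : ℂ) * w) * φ t ∂m with hF
  set U : Set ℂ := {w | -(1 / 2) < w.re}
  have hU : IsOpen U := isOpen_lt continuous_const Complex.continuous_re
  have hconn : IsPreconnected U := (convex_halfSpace_re_gt _).isPreconnected
  have hmem : ((1 / 2 : ℝ) : ℂ) ∈ U := by
    change -(1 / 2) < ((1 / 2 : ℝ) : ℂ).re
    rw [Complex.ofReal_re]
    norm_num
  have hfreq : ∃ᶠ w in 𝓝[≠] ((1 / 2 : ℝ) : ℂ), F w = 0 := by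
    have htend : Tendsto (fun x : ℝ => (x : ℂ)) (𝓝[≠] (1 / 2)) (𝓝[≠] ((1 / 2 : ℝ) : ℂ)) :=
      Complex.continuous_ofReal.continuousAt.tendsto.inf
        (tendsto_principal_principal.2 fun x hx h => hx (Complex.ofReal_injective h))
    refine htend.frequently (Eventually.frequently ?_)
    have : ∀ᶠ x : ℝ in 𝓝 (1 / 2), x ∈ Icc (0 : ℝ) 1 := Icc_mem_nhds (by norm_num) (by norm_num)
    filter_upwards [this.filter_mono nhdsWithin_le_nhds] with x hx
    exact h x hx.1 hx.2
  have hzero := ((differentiableOn_laplace φ).analyticOnNhd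
    hU).eqOn_zero_of_preconnected_of_frequently_eq_zero hconn hmem hfreq
  refine laplace_injective ?_
  rw [map_zero]
  funext w
  exact hzero w.2

theorem not_hasEigenvalue_opKz {z : ℂ} (hz : ‖z‖ < 1) :
    ¬ Module.End.HasEigenvalue (opKz z : L2m →ₗ[ℂ] L2m) 1 := by
  intro h
  obtain ⟨φ, hφ⟩ := h.exists_hasEigenvector
  have h1 : opKz z φ = φ := by simpa using hφ.apply_eq_smul
  exact hφ.2 (eq_zero_of_laplace_realPoint_eq_zero fun x hx hx1 =>
    laplace_eq_zero_of_fixed hz h1 hx hx1)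

/-! ### The Fredholm alternative for `𝓚_z` and its transport to `H1`. -/

/-- Write `𝓚_z = B 𝓚` with `B` bounded and approximate `𝓚` within `(‖B‖ + 1)⁻¹`: the remainder has
norm below `1`. This needs only boundedness of `B`, so it holds on the cut too, whatever
`Ring.inverse` returns there. -/
theorem exists_isUnit_one_sub_opKz_sub (z : ℂ) :
    ∃ (n : ℕ) (e : Fin n → L2m →L[ℂ] ℂ) (u : Fin n → L2m),
      IsUnit (1 - (opKz z - finiteRankOp e u 1)) := by
  set B : L2m →L[ℂ] L2m := z • ((1 - opM) * Ring.inverse (1 - z • opM)) with hB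
  have hpos : 0 < ‖B‖ + 1 := by positivity
  obtain ⟨n, e, u, h⟩ := exists_finiteRank_opK (ε := (‖B‖ + 1)⁻¹) (by positivity)
  refine ⟨n, e, fun i => B (u i), isUnit_one_sub_of_norm_lt_one ?_⟩
  have hF : finiteRankOp e (fun i => B (u i)) 1 = B * finiteRankOp e u 1 := by
    ext1 x
    rw [mul_apply_eq_comp, finiteRankOp_one_apply, finiteRankOp_one_apply, map_sum]
    simp only [map_smul]
  have hK : opKz z = B * opK := by rw [hB, smul_mul_assoc]; rfl
  rw [hF, hK, ← mul_sub]
  calc ‖B * (opK - finiteRankOp e u 1)‖ ≤ ‖B‖ * (‖B‖ + 1)⁻¹ :=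
        (norm_mul_le _ _).trans (by gcongr)
    _ < 1 := by rw [← div_eq_mul_inv, div_lt_one hpos]; linarith

theorem isUnit_one_sub_opKz_iff (z : ℂ) :
    IsUnit (1 - opKz z) ↔ ¬ Module.End.HasEigenvalue (opKz z : L2m →ₗ[ℂ] L2m) 1 := by
  obtain ⟨n, e, u, h⟩ := exists_isUnit_one_sub_opKz_sub z
  exact ⟨fun hu he => not_isUnit_of_hasEigenvalue_one he hu,
    fun he => (isUnit_or_hasEigenvalue_one e u h).resolve_right he⟩

/-- The operators `𝓠_z` on `H₁`, for all `z` in the cut plane, as the conjugates of `𝓚_z` under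
the Laplace transform. -/
noncomputable def opQ (z : ℂ) : H1 →L[ℂ] H1 :=
  laplaceIsometry.toContinuousLinearEquiv.conjContinuousAlgEquiv (opKz z)

theorem isTransferOperator_opQ {z : ℂ} (hz : ‖z‖ < 1) : IsTransferOperator z (opQ z) := by
  intro f w
  obtain ⟨φ, rfl⟩ := laplaceIsometry.surjective f
  have h : opQ z (laplaceIsometry φ) = laplaceIsometry (opKz z φ) := by
    change laplaceIsometry (opKz z (laplaceIsometry.symm (laplaceIsometry φ))) = _
    rw [LinearIsometryEquiv.symm_apply_apply]
  rw [h]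
  exact hasSum_laplace_opKz hz φ w

theorem analyticAt_opQ {z : ℂ} (hz : z ∈ cutPlane) : AnalyticAt ℂ opQ z :=
  ((laplaceIsometry.toContinuousLinearEquiv.arrowCongr
    laplaceIsometry.toContinuousLinearEquiv : (L2m →L[ℂ] L2m) ≃L[ℂ] (H1 →L[ℂ] H1)) :
      (L2m →L[ℂ] L2m) →L[ℂ] (H1 →L[ℂ] H1)).analyticAt _ |>.comp_of_eq (analyticAt_opKz hz) rfl

theorem isUnit_one_sub_opQ_iff (z : ℂ) : IsUnit (1 - opQ z) ↔ IsUnit (1 - opKz z) := by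
  unfold opQ
  rw [← map_one laplaceIsometry.toContinuousLinearEquiv.conjContinuousAlgEquiv, ← map_sub]
  exact MulEquiv.isUnit_map _

theorem meromorphicAt_inverse_opQ {z : ℂ} (hz : z ∈ cutPlane) :
    MeromorphicAt (fun z => Ring.inverse (1 - opQ z)) z := by
  obtain ⟨n, e, u, h⟩ := exists_isUnit_one_sub_opKz_sub z
  set Ψ := laplaceIsometry.toContinuousLinearEquiv.conjContinuousAlgEquiv with hΨ
  refine meromorphicAt_inverse_one_sub
    (fun i => (e i).comp (laplaceIsometry.symm.toContinuousLinearEquiv : H1 →L[ℂ] L2m))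
    (fun i => laplaceIsometry (u i)) (analyticAt_opQ hz) ?_
  -- Conjugation keeps the finite-rank form: functionals are composed with the inverse isometry,
  -- vectors are pushed forward.
  have hF : finiteRankOp
      (fun i => (e i).comp (laplaceIsometry.symm.toContinuousLinearEquiv : H1 →L[ℂ] L2m))
      (fun i => laplaceIsometry (u i)) 1 = Ψ (finiteRankOp e u 1) := by
    ext1 f
    change _ = laplaceIsometry (finiteRankOp e u 1 (laplaceIsometry.symm f))
    rw [finiteRankOp_one_apply, finiteRankOp_one_apply, map_sum]
    simp only [map_smul]
    rfl
  have := h.map Ψ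
  rwa [map_sub, map_one, map_sub, ← hF] at this

/-! ### The resolvent does not vanish identically near any point. -/

/-- Ensures `1 ≠ 0` among the operators on `H1`, so that the resolvent is nonzero at `z = 0`. The
constant `1` is a nonzero element because the density is positive on the half-line. -/
theorem nontrivial_L2m : Nontrivial L2m := by
  refine ⟨⟨(memLp_const (1 : ℂ)).toLp, 0, fun h => ?_⟩⟩
  have h1 : ∀ᵐ t ∂m, False := by
    filter_upwards [(memLp_const (μ := m) (p := 2) (1 : ℂ)).coeFn_toLp,
      Lp.eq_zero_iff_ae_eq_zero.1 h] with t h2 h3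
    rw [h3] at h2
    exact zero_ne_one h2
  unfold m at h1
  rw [ae_withDensity_iff measurable_mDensity.ennreal_ofReal,
    ae_restrict_iff' measurableSet_Ioi] at h1
  have h2 : ∀ᵐ t : ℝ, t ∉ Ioi (0 : ℝ) := by
    filter_upwards [h1] with t ht h0
    have h0' : 0 < t := h0
    refine ht h0 (ENNReal.ofReal_pos.2 ?_).ne'
    exact div_pos h0' (by linarith [Real.add_one_lt_exp h0'.ne'])
  have h3 : volume (Ioi (0 : ℝ)) = 0 := measure_eq_zero_iff_ae_notMem.2 h2
  simp at h3

theorem zero_mem_cutPlane : (0 : ℂ) ∈ cutPlane := by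
  intro x hx h
  have : x = 0 := by exact_mod_cast h.symm
  linarith

theorem ball_subset_cutPlane : Metric.ball (0 : ℂ) 1 ⊆ cutPlane := by
  intro z hz x hx h
  rw [mem_ball_zero_iff, h, Complex.norm_real, Real.norm_of_nonneg (by linarith)] at hz
  linarith

/-- The cut plane is star-shaped about `0`: if `a z` lies on the ray with `0 < a ≤ 1`, so does `z`.
-/
theorem isConnected_cutPlane : IsConnected cutPlane := by
  have hstar : StarConvex ℝ (0 : ℂ) cutPlane := by
    rw [starConvex_zero_iff]
    intro z hz a ha0 ha1 x hx h
    have ha : a ≠ 0 := by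
      rintro rfl
      rw [zero_smul] at h
      exact zero_mem_cutPlane x hx h
    have hapos : 0 < a := lt_of_le_of_ne ha0 ha.symm
    refine hz (x / a) ((one_le_div hapos).2 (ha1.trans hx)) ?_
    rw [Complex.real_smul] at h
    rw [Complex.ofReal_div, ← h, mul_div_cancel_left₀ _ (Complex.ofReal_ne_zero.2 ha)]
  exact (hstar.isPathConnected zero_mem_cutPlane).isConnected

/-- At `z = 0` the resolvent is analytic with value `1`, so its order is finite there, and
finiteness of the order propagates over the connected cut plane. This rules out the default value
`0` on an open set, where poles would go unseen. -/
theorem meromorphicOrderAt_inverse_opQ_ne_top {z : ℂ} (hz : z ∈ cutPlane) :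
    meromorphicOrderAt (fun z => Ring.inverse (1 - opQ z)) z ≠ ⊤ := by
  have hmer : MeromorphicOn (fun z => Ring.inverse (1 - opQ z)) cutPlane :=
    fun z hz => meromorphicAt_inverse_opQ hz
  refine (hmer.exists_meromorphicOrderAt_ne_top_iff_forall isConnected_cutPlane).1
    ⟨⟨0, zero_mem_cutPlane⟩, ?_⟩ ⟨z, hz⟩
  have hQ0 : opQ 0 = 0 := by simp [opQ, opKz]
  have han : AnalyticAt ℂ (fun z => Ring.inverse (1 - opQ z)) 0 :=
    analyticAt_inverse_one_sub_of_isUnit (analyticAt_opQ zero_mem_cutPlane) (by simp [hQ0])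
  have := nontrivial_L2m
  have : Nontrivial H1 := laplaceIsometry.symm.toEquiv.nontrivial
  have hne : (fun z => Ring.inverse (1 - opQ z)) 0 ≠ 0 := by simp [hQ0]
  rw [meromorphicOrderAt_ne_top_iff_eventually_ne_zero han.meromorphicAt]
  exact (han.continuousAt.eventually_ne hne).filter_mono nhdsWithin_le_nhds

end FareyGauss

theorem corollary2 :
    ∃ Q : ℂ → (FareyGauss.H1 →L[ℂ] FareyGauss.H1),
      (∀ z ∈ Metric.ball (0 : ℂ) 1, FareyGauss.IsTransferOperator z (Q z)) ∧
      AnalyticOnNhd ℂ Q FareyGauss.cutPlane ∧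
      (∀ z ∈ Metric.ball (0 : ℂ) 1, IsUnit (1 - Q z)) ∧
      AnalyticOnNhd ℂ (fun z => Ring.inverse (1 - Q z)) (Metric.ball (0 : ℂ) 1) ∧
      MeromorphicOn (fun z => Ring.inverse (1 - Q z)) FareyGauss.cutPlane ∧
      ∀ z ∈ FareyGauss.cutPlane,
        (meromorphicOrderAt (fun ζ => Ring.inverse (1 - Q ζ)) z < 0 ↔
          Module.End.HasEigenvalue
            (FareyGauss.opKz z : FareyGauss.L2m →ₗ[ℂ] FareyGauss.L2m) 1) ∧
        (¬ Module.End.HasEigenvalue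
            (FareyGauss.opKz z : FareyGauss.L2m →ₗ[ℂ] FareyGauss.L2m) 1 →
          IsUnit (1 - Q z) ∧ AnalyticAt ℂ (fun ζ => Ring.inverse (1 - Q ζ)) z) := by

  have hunit : ∀ z, IsUnit (1 - FareyGauss.opQ z) ↔ ¬ Module.End.HasEigenvalue
      (FareyGauss.opKz z : FareyGauss.L2m →ₗ[ℂ] FareyGauss.L2m) 1 := fun z =>
    (FareyGauss.isUnit_one_sub_opQ_iff z).trans (FareyGauss.isUnit_one_sub_opKz_iff z)
  have hball : ∀ z ∈ Metric.ball (0 : ℂ) 1, IsUnit (1 - FareyGauss.opQ z) := fun z hz =>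
    (hunit z).2 (FareyGauss.not_hasEigenvalue_opKz (mem_ball_zero_iff.1 hz))
  refine ⟨FareyGauss.opQ,
    fun z hz => FareyGauss.isTransferOperator_opQ (mem_ball_zero_iff.1 hz),
    fun z hz => FareyGauss.analyticAt_opQ hz, hball,
    fun z hz => FareyGauss.analyticAt_inverse_one_sub_of_isUnit
      (FareyGauss.analyticAt_opQ (FareyGauss.ball_subset_cutPlane hz)) (hball z hz),
    fun z hz => FareyGauss.meromorphicAt_inverse_opQ hz, fun z hz => ⟨?_, fun he => ?_⟩⟩
  · rw [FareyGauss.meromorphicOrderAt_inverse_neg_iff (FareyGauss.analyticAt_opQ hz)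
      (FareyGauss.meromorphicAt_inverse_opQ hz)
      (FareyGauss.meromorphicOrderAt_inverse_opQ_ne_top hz), hunit, not_not]
  · have hu := (hunit z).2 he
    exact ⟨hu, FareyGauss.analyticAt_inverse_one_sub_of_isUnit (FareyGauss.analyticAt_opQ hz) hu⟩
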